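/- **Theorem.** $\mathrm{StoqMA}\subseteq\mathrm{SBP}$, where the classes are the following classes of promise problems $(L_{yes},L_{no})$, $L_{yes},L_{no}\subseteq\{0,1\}^*$ disjoint. *SBP.* $(L_{yes},L_{no})\in\mathrm{SBP}$ iff there are a function $F\in\#\mathrm{P}$ and a strictly positive rational-valued function $f$ on $\{0,1\}^*$, computable in polynomial time (numerator and denominator in binary), such that $F(x)\ge f(x)$ for all $x\in L_{yes}$ and $F(x)\le \frac12 f(x)$ for all $x\in L_{no}$. Here $F\in\#\mathrm{P}$ means that there are a polynomial $p$ and a polynomial-time predicate $R$ with $F(x)=\#\{w\in\{0,1\}^{p(|x|)} : R(x,w)=1\}$ for all $x$. *StoqMA.* A stoquastic verifier is a tuple $V=(n,n_w,n_0,n_+,U)$ with $n+n_w+n_0+n_+\ge 1$, where $U$ is a circuit of $X$, CNOT and Toffoli gates on $n+n_w+n_0+n_+$ qubits. Its acceptance probability on an input $x\in\{0,1\}^n$ and a normalized witness state $|\psi\rangle\in(\mathbb{C}^2)^{\otimes n_w}$ is $$\Pr(V;x,\psi)=\langle\psi_{in}|U^\dagger(|+\rangle\langle+|_1\otimes I)U|\psi_{in}\rangle,\qquad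 |\psi_{in}\rangle=|x\rangle\otimes|\psi\rangle\otimes|0\rangle^{\otimes n_0}\otimes|+\rangle^{\otimes n_+},$$ where $|+\rangle=(|0\rangle+|1\rangle)/\sqrt2$ and $|+\rangle\langle +|_1$ acts on the first qubit. Then $(L_{yes},L_{no})\in\mathrm{StoqMA}$ iff there are a family $(V_n)_{n\ge0}$ of stoquastic verifiers, $V_n$ having $n$ input bits, at most polynomially many qubits and gates, and a description computable in polynomial time from $1^n$, and rational thresholds $0\le\epsilon_{no}(n)<\epsilon_{yes}(n)\le1$, computable in polynomial time from $1^n$, with $\epsilon_{yes}(n)-\epsilon_{no}(n)\ge 1/q(n)$ for some polynomial $q$ with positive values, such that for every $x$, with $n=|x|$: - if $x\in L_{yes}$, then $\Pr(V_n;x,\psi)\ge\epsilon_{yes}(n)$ for some normalized $|\psi\rangle$; - if $x\in L_{no}$, then $\Pr(V_n;x,\psi)\le\epsilon_{no}(n)$ for all normalized $|\psi\rangle$. -/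

import Mathlib

namespace Stoq

open Computability

/-! ### Polynomial time -/

/-- `f` is computed by a (multi-stack) Turing machine in a number of steps bounded by a polynomial in
the length of the encoded input; `ea` and `eb` encode inputs and outputs as strings. The machine has
finitely many labels, states and stacks and a finite input alphabet; the symbols it can push are
values of functions on its finite state set, so the other alphabets are in effect finite too. -/
def PolyTime {α β Γ₁ Γ₂ : Type} (ea : α → List Γ₁) (eb : β → List Γ₂) (f : α → β) : Prop :=
  Nonempty (Turing.TM2ComputableInPolyTime ea eb f)

/-- The code of a pair of bit strings, over a two-coloured copy of the binary alphabet. -/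
def encodeStrings : List Bool × List Bool → List (Bool ⊕ Bool) :=
  (encodingProd (encodingList Bool) (encodingList Bool)).encode

/-- The code of a pair of natural numbers, both written in binary. -/
def encodeNats : ℕ × ℕ → List (Bool ⊕ Bool) :=
  (encodingProd encodingNatBool encodingNatBool).encode

/-- A non-negative function with rational values is computable in polynomial time: some
polynomial-time machine outputs a numerator and a non-zero denominator, in binary. The fraction
need not be reduced. -/
def PolyTimeFraction {α Γ : Type} (ea : α → List Γ) (f : α → ℝ) : Prop :=
  ∃ g : α → ℕ × ℕ, PolyTime ea encodeNats g ∧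
    ∀ a, 0 < (g a).2 ∧ f a = ((g a).1 : ℝ) / ((g a).2 : ℝ)

/-! ### Promise problems and the class SBP -/

/-- A promise problem: disjoint sets of yes-instances and no-instances among all bit strings. -/
structure PromiseProblem where
  yes : Set (List Bool)
  no : Set (List Bool)
  disjoint : Disjoint yes no

/-- The class #P: functions counting the witnesses, of length a fixed polynomial in the length of
the input, that are accepted by a polynomial-time predicate. -/
def SharpP : Set (List Bool → ℕ) :=
  {F | ∃ (p : Polynomial ℕ) (R : List Bool × List Bool → Bool),
    PolyTime encodeStrings encodeBool R ∧
    ∀ x, F x = (Finset.univ.filter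
      fun w : Fin (p.eval x.length) → Bool => R (x, List.ofFn w) = true).card}

/-- The class SBP. The threshold is strictly positive: with the value `0` allowed, the two
conditions would hold together for `F = 0` and every promise problem would qualify. -/
def SBP : Set PromiseProblem :=
  {L | ∃ F ∈ SharpP, ∃ f : List Bool → ℝ,
    (∀ x, 0 < f x) ∧
    PolyTimeFraction (id : List Bool → List Bool) f ∧
    (∀ x ∈ L.yes, f x ≤ (F x : ℝ)) ∧
    (∀ x ∈ L.no, (F x : ℝ) ≤ (1 / 2) * f x)}

/-! ### Circuits -/

/-- The gates X, CNOT (control, target) and Toffoli (two controls, target) on `N` qubits, acting on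
distinct qubits. -/
inductive Gate (N : ℕ) where
  | X (t : Fin N) : Gate N
  | CNOT (c t : Fin N) (h : c ≠ t) : Gate N
  | Toffoli (c₁ c₂ t : Fin N) (h : c₁ ≠ c₂) (h₁ : c₁ ≠ t) (h₂ : c₂ ≠ t) : Gate N

/-- The action of a gate on the labels of the computational basis vectors. -/
def Gate.apply {N : ℕ} : Gate N → (Fin N → Bool) → (Fin N → Bool)
  | .X t, b => Function.update b t (!b t)
  | .CNOT c t _, b => Function.update b t (xor (b t) (b c))
  | .Toffoli c₁ c₂ t _ _ _, b => Function.update b t (xor (b t) (b c₁ && b c₂))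

/-- The unitary matrix of a gate in the computational basis. -/
def Gate.matrix {N : ℕ} (g : Gate N) : Matrix (Fin N → Bool) (Fin N → Bool) ℂ :=
  Matrix.of fun b' b => if b' = g.apply b then 1 else 0

/-- The unitary matrix of a circuit; the head of the list is the gate applied first. -/
def circuitMatrix {N : ℕ} : List (Gate N) → Matrix (Fin N → Bool) (Fin N → Bool) ℂ
  | [] => 1
  | g :: gs => circuitMatrix gs * g.matrix

/-! ### Stoquastic verifiers -/

/-- A stoquastic verifier with `n` input bits. The qubits are ordered: input, witness, ancillas
`|0⟩`, ancillas `|+⟩`. There is at least one qubit, as the first one is measured. -/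
structure StoqVerifier (n : ℕ) where
  /-- number of witness qubits -/
  nw : ℕ
  /-- number of ancillas `|0⟩` -/
  n0 : ℕ
  /-- number of ancillas `|+⟩` -/
  np : ℕ
  pos : 0 < n + nw + n0 + np
  gates : List (Gate (n + nw + n0 + np))

namespace StoqVerifier

variable {n : ℕ} (V : StoqVerifier n)

/-- The total number of qubits. -/
abbrev qubits : ℕ := n + V.nw + V.n0 + V.np

/-- The part of a basis label that belongs to the input qubits. -/
def inputPart (b : Fin V.qubits → Bool) : Fin n → Bool :=
  fun i => b (Fin.castAdd V.np (Fin.castAdd V.n0 (Fin.castAdd V.nw i)))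

/-- The part of a basis label that belongs to the witness qubits. -/
def witnessPart (b : Fin V.qubits → Bool) : Fin V.nw → Bool :=
  fun i => b (Fin.castAdd V.np (Fin.castAdd V.n0 (Fin.natAdd n i)))

/-- The part of a basis label that belongs to the ancillas `|0⟩`. -/
def zeroPart (b : Fin V.qubits → Bool) : Fin V.n0 → Bool :=
  fun i => b (Fin.castAdd V.np (Fin.natAdd (n + V.nw) i))

/-- The initial state `|x⟩ ⊗ |ψ⟩ ⊗ |0⟩^{⊗ n0} ⊗ |+⟩^{⊗ np}`; every amplitude of the last factor is
`(1/√2)^np`. -/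
noncomputable def initialState (x : Fin n → Bool) (ψ : (Fin V.nw → Bool) → ℂ) :
    (Fin V.qubits → Bool) → ℂ :=
  fun b => (if V.inputPart b = x then 1 else 0) * ψ (V.witnessPart b) *
    (if V.zeroPart b = fun _ => false then 1 else 0) * ((1 / Real.sqrt 2 : ℝ) : ℂ) ^ V.np

/-- The projector `|+⟩⟨+| ⊗ I` for the first qubit; all entries of `|+⟩⟨+|` are `1/2`. -/
noncomputable def outProjector : Matrix (Fin V.qubits → Bool) (Fin V.qubits → Bool) ℂ :=
  Matrix.of fun b' b => if ∀ i, i ≠ (⟨0, V.pos⟩ : Fin V.qubits) → b' i = b i then 1 / 2 else 0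

/-- The acceptance probability `⟨ψ_in| U† Π_out U |ψ_in⟩`. -/
noncomputable def acceptProb (x : Fin n → Bool) (ψ : (Fin V.nw → Bool) → ℂ) : ℝ :=
  (star (V.initialState x ψ) ⬝ᵥ
    (((circuitMatrix V.gates).conjTranspose * V.outProjector * circuitMatrix V.gates).mulVec
      (V.initialState x ψ))).re

end StoqVerifier

/-- A vector of amplitudes on `m` qubits is a (normalized) state. -/
def IsState {m : ℕ} (ψ : (Fin m → Bool) → ℂ) : Prop :=
  ∑ w, ‖ψ w‖ ^ 2 = 1

/-! ### Uniform families and the class StoqMA -/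

/-- A list of natural numbers as a bit string; each number is written in unary and followed by the
end marker `false`. -/
def encodeTallies (l : List ℕ) : List Bool :=
  l.flatMap fun k => List.replicate k true ++ [false]

/-- A gate as a type tag followed by the indices of its qubits. -/
def Gate.code {N : ℕ} : Gate N → List ℕ
  | .X t => [0, t]
  | .CNOT c t _ => [1, c, t]
  | .Toffoli c₁ c₂ t _ _ _ => [2, c₁, c₂, t]

/-- The description of a verifier as a bit string: the numbers of witness qubits and ancillas,
then the gates in the order of application. -/
def StoqVerifier.encode {n : ℕ} (V : StoqVerifier n) : List Bool :=
  encodeTallies ([V.nw, V.n0, V.np] ++ V.gates.flatMap Gate.code)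

/-- A family of verifiers is uniform if a polynomial-time machine maps the string `1ⁿ` to a
description of the verifier for `n` input bits. -/
def Uniform (V : ∀ n, StoqVerifier n) : Prop :=
  PolyTime unaryEncodeNat (id : List Bool → List Bool) fun n => (V n).encode

/-- The class StoqMA. The thresholds `εyes`, `εno` are functions of the input length, computable in
polynomial time from `1ⁿ`, and separated by an inverse polynomial. -/
def StoqMA : Set PromiseProblem :=
  {L | ∃ (V : ∀ n, StoqVerifier n) (εyes εno : ℕ → ℝ),
    Uniform V ∧
    (∃ q : Polynomial ℕ, ∀ n, (V n).qubits ≤ q.eval n ∧ (V n).gates.length ≤ q.eval n) ∧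
    PolyTimeFraction unaryEncodeNat εyes ∧
    PolyTimeFraction unaryEncodeNat εno ∧
    (∀ n, 0 ≤ εno n ∧ εno n < εyes n ∧ εyes n ≤ 1) ∧
    (∃ q : Polynomial ℕ, ∀ n, 0 < q.eval n ∧ 1 / ((q.eval n : ℕ) : ℝ) ≤ εyes n - εno n) ∧
    (∀ x ∈ L.yes, ∃ ψ, IsState ψ ∧
      εyes x.length ≤ (V x.length).acceptProb x.get ψ) ∧
    (∀ x ∈ L.no, ∀ ψ, IsState ψ →
      (V x.length).acceptProb x.get ψ ≤ εno x.length)}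

end Stoq

/-!
The acceptance probability of a stoquastic verifier is a quadratic form `⟨ψ|A|ψ⟩`, where `A`
depends on the input and is a positive semidefinite matrix with non-negative entries, indexed by
witness strings. The sum of all entries of `Aᵏ` is at least `εyesᵏ` on yes-instances (log-convexity
of the moments of `A` at the non-negative vector `|ψ|`) and at most `2 ^ nw * εnoᵏ` on
no-instances.

Up to a power of two, this sum counts strings: since `|+⟩⟨+| = (1 + X) / 2`, an entry of `A` is
proportional to the number of random bits for which running the reversible circuit, flipping the
first qubit or not, and undoing the circuit leads from one witness string to another with the input
and the zeros restored; an entry of `Aᵏ` counts `k` such rounds in a row. For `k` a suitable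
polynomial, the gap between the two bounds exceeds the factor 2 required by SBP.

Polynomial time means a multi-stack Turing machine, so the predicate that checks the rounds is built
from programs with a finite control acting on stacks.
-/

namespace Stoq

open Computability Turing Function

/-! ### Bounded executions of stack machines -/

section Exec

variable {K : Type} [DecidableEq K] {Γ : K → Type} {Λ σ : Type}

/-- The machine `m` leads from one configuration to another in at most `t` steps. Unlike
`StateTransition.EvalsToInTime` this is a proposition, and it is built step by step. -/
inductive Exec (m : Λ → TM2.Stmt Γ Λ σ) : ℕ → TM2.Cfg Γ Λ σ → TM2.Cfg Γ Λ σ → Prop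
  | refl (t : ℕ) (c : TM2.Cfg Γ Λ σ) : Exec m t c c
  | step {t : ℕ} {l : Λ} {s : σ} {S : ∀ k, List (Γ k)} {c : TM2.Cfg Γ Λ σ} :
      Exec m t (TM2.stepAux (m l) s S) c → Exec m (t + 1) ⟨some l, s, S⟩ c

variable {m : Λ → TM2.Stmt Γ Λ σ} {c c' c'' : TM2.Cfg Γ Λ σ} {t t' : ℕ}

theorem Exec.mono (h : Exec m t c c') (ht : t ≤ t') : Exec m t' c c' := by
  induction h generalizing t' with
  | refl => exact .refl _ _
  | step _ ih =>
    obtain ⟨s, rfl⟩ := Nat.exists_eq_add_of_le' (Nat.one_le_of_lt ht)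
    exact .step (ih (by omega))

theorem Exec.trans (h : Exec m t c c') (h' : Exec m t' c' c'') : Exec m (t + t') c c'' := by
  induction h with
  | refl => exact h'.mono (Nat.le_add_left _ _)
  | step _ ih => exact (ih h').step.mono (by omega)

theorem Exec.exists_iterate (h : Exec m t c c') :
    ∃ n ≤ t, (flip bind (TM2.step m))^[n] (some c) = some c' := by
  induction h with
  | refl => exact ⟨0, Nat.zero_le _, rfl⟩
  | step _ ih =>
    obtain ⟨n, hn, e⟩ := ih
    exact ⟨n + 1, by omega, by rw [iterate_succ_apply]; exact e⟩

theorem Exec.of_iterate {n : ℕ} (hn : n ≤ t)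
    (h : (flip bind (TM2.step m))^[n] (some c) = some c') : Exec m t c c' := by
  induction n generalizing c t with
  | zero =>
    simp only [iterate_zero, id, Option.some.injEq] at h
    exact h ▸ .refl _ _
  | succ n ih =>
    obtain ⟨s, rfl⟩ := Nat.exists_eq_add_of_le' (Nat.one_le_of_lt hn)
    rw [iterate_succ_apply] at h
    obtain ⟨_ | l, s, S⟩ := c
    · have halted : (flip bind (TM2.step m))^[n] none = some c' := h
      rw [iterate_fixed rfl] at halted
      cases halted
    · exact .step (ih (by omega) h)

theorem exec_iff : Exec m t c c' ↔
    Nonempty (StateTransition.EvalsToInTime (TM2.step m) c (some c') t) := by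
  constructor
  · intro h
    obtain ⟨n, hn, e⟩ := h.exists_iterate
    exact ⟨⟨⟨n, e⟩, hn⟩⟩
  · rintro ⟨⟨n, e⟩, hn⟩
    exact .of_iterate hn e

/-- The number of pushes in a statement. It bounds the growth of a stack in one step, and so the
length of the output of a machine in terms of its running time. -/
def pushCount : TM2.Stmt Γ Λ σ → ℕ
  | .push _ _ q => pushCount q + 1
  | .peek _ _ q => pushCount q
  | .pop _ _ q => pushCount q
  | .load _ q => pushCount q
  | .branch _ q₁ q₂ => pushCount q₁ + pushCount q₂
  | .goto _ => 0
  | .halt => 0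

theorem length_stepAux_le (q : TM2.Stmt Γ Λ σ) (s : σ) (S : ∀ k, List (Γ k)) (k : K) :
    ((TM2.stepAux q s S).stk k).length ≤ (S k).length + pushCount q := by
  induction q generalizing s S with
  | push k' f q ih =>
    refine (ih _ _).trans ?_
    obtain rfl | h := eq_or_ne k k'
    · simp only [update_self, List.length_cons, pushCount]
      omega
    · simp [pushCount, h]
  | peek _ _ _ ih => exact ih _ _
  | pop k' f q ih =>
    refine (ih _ _).trans ?_
    obtain rfl | h := eq_or_ne k k'
    · simp [pushCount]
    · simp [pushCount, h]
  | load _ _ ih => exact ih _ _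
  | branch f q₁ q₂ ih₁ ih₂ =>
    simp only [TM2.stepAux, pushCount]
    cases f s
    · exact (ih₂ _ _).trans (by omega)
    · exact (ih₁ _ _).trans (by omega)
  | goto f => exact Nat.le_add_right _ _
  | halt => exact Nat.le_add_right _ _

theorem Exec.length_le {b : ℕ} (hb : ∀ l, pushCount (m l) ≤ b) (h : Exec m t c c') (k : K) :
    (c'.stk k).length ≤ (c.stk k).length + b * t := by
  induction h with
  | refl => exact Nat.le_add_right _ _
  | @step t l s S _ _ ih =>
    calc _ ≤ ((TM2.stepAux (m l) s S).stk k).length + b * t := ih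
      _ ≤ (S k).length + b + b * t := by
        gcongr
        exact (length_stepAux_le (m l) s S k).trans (Nat.add_le_add_left (hb l) _)
      _ = (S k).length + b * (t + 1) := by ring

end Exec

/-! ### Programs that call machines -/

section Stacks

variable {I V : Type} {M : I → FinTM2} {alph : V → Type}

/-- The stacks of a machine that has the stacks `V` of its own and those of all machines `M i`. -/
abbrev Stk (M : I → FinTM2) (V : Type) : Type := (Σ i, (M i).K) ⊕ V

/-- The alphabets of the stacks `Stk M V`. -/
abbrev StkAlph (M : I → FinTM2) (alph : V → Type) : Stk M V → Type
  | .inl k => (M k.1).Γ k.2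
  | .inr v => alph v

/-- The stack contents consisting of `T` on the stacks of the machines `M i` and of `U` on `V`. -/
def join (T : ∀ i k, List ((M i).Γ k)) (U : ∀ v, List (alph v)) :
    ∀ k, List (StkAlph M alph k)
  | .inl k => T k.1 k.2
  | .inr v => U v

@[simp]
theorem join_inl (T : ∀ i k, List ((M i).Γ k)) (U : ∀ v, List (alph v)) (i : I) (k : (M i).K) :
    join T U (.inl ⟨i, k⟩) = T i k := rfl

@[simp]
theorem join_inr (T : ∀ i k, List ((M i).Γ k)) (U : ∀ v, List (alph v)) (v : V) :
    join T U (.inr v) = U v := rfl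

variable [DecidableEq I] [DecidableEq V]

theorem update_join_inl (T : ∀ i k, List ((M i).Γ k)) (U : ∀ v, List (alph v)) (i : I)
    (k : (M i).K) (L : List ((M i).Γ k)) :
    update (join T U) (.inl ⟨i, k⟩) L = join (update T i (update (T i) k L)) U := by
  funext x
  obtain ⟨j, k'⟩ | v := x
  · obtain rfl | hj := eq_or_ne j i
    · obtain rfl | hk := eq_or_ne k' k
      · simp
      · simp [hk]
    · have : (⟨j, k'⟩ : Σ i, (M i).K) ≠ ⟨i, k⟩ := fun e => hj (congrArg Sigma.fst e)
      simp [hj, this]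
  · simp

theorem update_join_inr (T : ∀ i k, List ((M i).Γ k)) (U : ∀ v, List (alph v)) (v : V)
    (L : List (alph v)) : update (join T U) (.inr v) L = join T (update U v L) := by
  funext x
  obtain k | w := x
  · simp [join]
  · obtain rfl | h := eq_or_ne w v
    · simp
    · simp [h]

end Stacks

section Embed

variable {I V : Type} [DecidableEq I] [DecidableEq V] {M : I → FinTM2} {alph : V → Type}
  {Λ : Type}

/-- The memory of a machine with labels `Λ` that calls the machines `M i`: their memories, and a
register for the label that the next step has to go to. -/
abbrev Mem (M : I → FinTM2) (Λ : Type) : Type := (∀ i, (M i).σ) × Λ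

/-- A statement of the machine `M i` as a statement of a machine that calls it; halting is replaced
by a jump to the label `exit`. -/
def embedStmt (i : I) (φ : (M i).Λ → Λ) (exit : Λ) :
    TM2.Stmt (M i).Γ (M i).Λ (M i).σ → TM2.Stmt (StkAlph M alph) Λ (Mem M Λ)
  | .push k f q => .push (.inl ⟨i, k⟩) (fun s => f (s.1 i)) (embedStmt i φ exit q)
  | .peek k f q =>
      .peek (.inl ⟨i, k⟩) (fun s o => (update s.1 i (f (s.1 i) o), s.2)) (embedStmt i φ exit q)
  | .pop k f q =>
      .pop (.inl ⟨i, k⟩) (fun s o => (update s.1 i (f (s.1 i) o), s.2)) (embedStmt i φ exit q)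
  | .load f q => .load (fun s => (update s.1 i (f (s.1 i)), s.2)) (embedStmt i φ exit q)
  | .branch f q₁ q₂ =>
      .branch (fun s => f (s.1 i)) (embedStmt i φ exit q₁) (embedStmt i φ exit q₂)
  | .goto f => .goto fun s => φ (f (s.1 i))
  | .halt => .goto fun _ => exit

/-- A configuration of the machine `M i` as a configuration of a machine that calls it. The
arguments `s`, `r`, `T` and `U` are the memory and the stacks that `M i` leaves alone. -/
def embedCfg (i : I) (φ : (M i).Λ → Λ) (exit : Λ) (s : ∀ i, (M i).σ) (r : Λ)
    (T : ∀ i k, List ((M i).Γ k)) (U : ∀ v, List (alph v))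
    (c : TM2.Cfg (M i).Γ (M i).Λ (M i).σ) : TM2.Cfg (StkAlph M alph) Λ (Mem M Λ) :=
  ⟨some (c.l.elim exit φ), (update s i c.var, r), join (update T i c.stk) U⟩

variable {i : I} {φ : (M i).Λ → Λ} {exit : Λ}

theorem stepAux_embedStmt (q : TM2.Stmt (M i).Γ (M i).Λ (M i).σ) (s : ∀ i, (M i).σ) (r : Λ)
    (T : ∀ i k, List ((M i).Γ k)) (U : ∀ v, List (alph v)) :
    TM2.stepAux (embedStmt i φ exit q) (s, r) (join T U) =
      embedCfg i φ exit s r T U (TM2.stepAux q (s i) (T i)) := by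
  induction q generalizing s T with
  | push k f q ih =>
    simp only [embedStmt, TM2.stepAux, update_join_inl, join_inl, ih]
    simp [embedCfg]
  | peek k f q ih =>
    simp only [embedStmt, TM2.stepAux, join_inl, ih]
    simp [embedCfg]
  | pop k f q ih =>
    simp only [embedStmt, TM2.stepAux, update_join_inl, join_inl, ih]
    simp [embedCfg]
  | load f q ih =>
    simp only [embedStmt, TM2.stepAux, ih]
    simp [embedCfg]
  | branch f q₁ q₂ ih₁ ih₂ =>
    simp only [embedStmt, TM2.stepAux]
    cases f (s i)
    · exact ih₂ s T
    · exact ih₁ s T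
  | goto f => simp [embedStmt, embedCfg]
  | halt => simp [embedStmt, embedCfg]

theorem Exec.embed {m : Λ → TM2.Stmt (StkAlph M alph) Λ (Mem M Λ)}
    (hm : ∀ l, m (φ l) = embedStmt i φ exit ((M i).m l)) {t : ℕ}
    {c c' : TM2.Cfg (M i).Γ (M i).Λ (M i).σ} (h : Exec (M i).m t c c') (s : ∀ i, (M i).σ) (r : Λ)
    (T : ∀ i k, List ((M i).Γ k)) (U : ∀ v, List (alph v)) :
    Exec m t (embedCfg i φ exit s r T U c) (embedCfg i φ exit s r T U c') := by
  induction h with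
  | refl => exact .refl _ _
  | @step t l v S _ _ ih =>
    refine .step ?_
    rw [Option.elim_some, hm, stepAux_embedStmt]
    simpa [embedCfg] using ih

end Embed

section Prog

variable {I V : Type}

/-- Structured programs on the stacks `V` that may call the machines `M i`:
* `push v w` pushes the symbols of `w` on `v`, one after the other;
* `seq p q` runs `p`, then `q`;
* `loop v body` pops the symbols of `v` until `v` is empty and runs `body a` for each symbol `a`;
* `call i v v' f g` empties `v`, runs `M i` on the image of the popped word under `f`, and pushes
  the image of the output under `g` on `v'`. As both transfers go through the top of a stack, `M i`
  gets the contents of `v` in reverse, and the first symbol of its output is pushed first. -/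
inductive Prog (M : I → FinTM2) (alph : V → Type) : Type
  | push (v : V) (w : List (alph v)) : Prog M alph
  | seq (p q : Prog M alph) : Prog M alph
  | loop (v : V) (body : alph v → Prog M alph) : Prog M alph
  | call (i : I) (v v' : V) (f : alph v → (M i).Γ (M i).k₀) (g : (M i).Γ (M i).k₁ → alph v') :
      Prog M alph

/-- The program that moves the contents of `v` to `v'`, in reverse and mapped by `f`. -/
def Prog.move {M : I → FinTM2} {alph : V → Type} (v v' : V) (f : alph v → alph v') :
    Prog M alph :=
  .loop v fun a => .push v' [f a]

/-- The labels of the part of a machine that calls another machine with labels `Λ`: a loop that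
loads the input, symbols of type `A`, the called machine, and a loop that stores the output, symbols
of type `B`. There is a label for each symbol as the symbol to be pushed must be a function of the
label and the memory. -/
inductive CallLabel (A Λ B : Type) : Type
  | load : CallLabel A Λ B
  | loadPush (a : A) : CallLabel A Λ B
  | run (l : Λ) : CallLabel A Λ B
  | store : CallLabel A Λ B
  | storePush (b : B) : CallLabel A Λ B

instance {A Λ B : Type} [Finite A] [Finite Λ] [Finite B] : Finite (CallLabel A Λ B) := by
  refine .of_surjective (α := Option A ⊕ Λ ⊕ Option B) (Sum.elim (fun a => a.elim .load .loadPush)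
    (Sum.elim .run fun b => b.elim .store .storePush)) ?_
  rintro (_ | a | l | _ | b)
  exacts [⟨.inl none, rfl⟩, ⟨.inl (some a), rfl⟩, ⟨.inr (.inl l), rfl⟩, ⟨.inr (.inr none), rfl⟩,
    ⟨.inr (.inr (some b)), rfl⟩]

variable {M : I → FinTM2} {alph : V → Type}

/-- The labels of the machine that a program is compiled to. -/
def Prog.Label : Prog M alph → Type
  | .push _ _ => Unit
  | .seq p q => p.Label ⊕ q.Label
  | .loop _ body => Option (Σ a, (body a).Label)
  | .call i v _ _ _ => CallLabel (alph v) (M i).Λ ((M i).Γ (M i).k₁)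

theorem Prog.finite_label [∀ v, Finite (alph v)] [∀ i, Finite ((M i).Γ (M i).k₁)]
    (p : Prog M alph) : Finite p.Label := by
  induction p with
  | push => exact inferInstanceAs (Finite Unit)
  | seq p q => exact inferInstanceAs (Finite (p.Label ⊕ q.Label))
  | loop v body => exact inferInstanceAs (Finite (Option (Σ a, (body a).Label)))
  | call i v =>
    have := (M i).ΛFin
    exact inferInstanceAs (Finite (CallLabel (alph v) (M i).Λ ((M i).Γ (M i).k₁)))

/-- The label at which the execution of a program starts. -/
def Prog.entry : (p : Prog M alph) → p.Label
  | .push _ _ => ()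
  | .seq p _ => .inl p.entry
  | .loop _ _ => none
  | .call _ _ _ _ _ => .load

/-- The statement that pushes the symbols of a word on the stack `v`, then goes to a label. -/
def pushWord {Λ : Type} (v : V) (next : Λ) :
    List (alph v) → TM2.Stmt (StkAlph M alph) Λ (Mem M Λ)
  | [] => .goto fun _ => next
  | a :: w => .push (.inr v) (fun _ => a) (pushWord v next w)

/-- The statement that pops a symbol from the stack `k` and goes to a label that depends on it. -/
def popTo {Λ : Type} (k : Stk M V) (next : Option (StkAlph M alph k) → Λ) :
    TM2.Stmt (StkAlph M alph) Λ (Mem M Λ) :=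
  .pop k (fun s o => (s.1, next o)) (.goto fun s => s.2)

/-- The code of the program `call i v v' f g` inside a machine with labels `Λ`. -/
def callStmt [DecidableEq I] {Λ : Type} {i : I} {v v' : V} (f : alph v → (M i).Γ (M i).k₀)
    (g : (M i).Γ (M i).k₁ → alph v') (φ : CallLabel (alph v) (M i).Λ ((M i).Γ (M i).k₁) → Λ)
    (exit : Λ) : CallLabel (alph v) (M i).Λ ((M i).Γ (M i).k₁) →
      TM2.Stmt (StkAlph M alph) Λ (Mem M Λ)
  | .load => popTo (.inr v) fun o => o.elim (φ (.run (M i).main)) fun a => φ (.loadPush a)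
  | .loadPush a => .push (.inl ⟨i, (M i).k₀⟩) (fun _ => f a) (.goto fun _ => φ .load)
  | .run l => embedStmt i (fun l => φ (.run l)) (φ .store) ((M i).m l)
  | .store => popTo (.inl ⟨i, (M i).k₁⟩) fun o => o.elim exit fun b => φ (.storePush b)
  | .storePush b => .push (.inr v') (fun _ => g b) (.goto fun _ => φ .store)

/-- The code of a program inside a machine with labels `Λ`: the labels of the program are embedded
by `φ`, and at the end the code goes to the label `exit`. -/
def Prog.compile [DecidableEq I] {Λ : Type} : (p : Prog M alph) → (p.Label → Λ) → Λ →
    p.Label → TM2.Stmt (StkAlph M alph) Λ (Mem M Λ)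
  | .push v w, _, exit, _ => pushWord v exit w
  | .seq p q, φ, _, .inl l => p.compile (fun l => φ (.inl l)) (φ (.inr q.entry)) l
  | .seq _ q, φ, exit, .inr l => q.compile (fun l => φ (.inr l)) exit l
  | .loop v body, φ, exit, none =>
      popTo (.inr v) fun o => o.elim exit fun a => φ (some ⟨a, (body a).entry⟩)
  | .loop _ body, φ, _, some ⟨a, l⟩ =>
      (body a).compile (fun l => φ (some ⟨a, l⟩)) (φ none) l
  | .call _ _ _ f g, φ, exit, l => callStmt f g φ exit l

variable [DecidableEq V]

/-- `Runs t p U U'`: the program `p` changes the contents `U` of the stacks to `U'`, and the machine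
it is compiled to needs at most `t` steps for that. -/
inductive Runs : ℕ → Prog M alph → (∀ v, List (alph v)) → (∀ v, List (alph v)) → Prop
  | push (v : V) (w : List (alph v)) (U : ∀ v, List (alph v)) :
      Runs 1 (.push v w) U (update U v (w.reverse ++ U v))
  | seq {s t : ℕ} {p q : Prog M alph} {U U' U'' : ∀ v, List (alph v)} :
      Runs s p U U' → Runs t q U' U'' → Runs (s + t) (.seq p q) U U''
  | loop_nil {v : V} {body : alph v → Prog M alph} {U : ∀ v, List (alph v)} :
      U v = [] → Runs 1 (.loop v body) U U
  | loop_cons {s t : ℕ} {v : V} {body : alph v → Prog M alph} {U U' U'' : ∀ v, List (alph v)}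
      {a : alph v} {L : List (alph v)} :
      U v = a :: L → Runs s (body a) (update U v L) U' → Runs t (.loop v body) U' U'' →
      Runs (s + t + 1) (.loop v body) U U''
  | call {s : ℕ} {i : I} {v v' : V} {f : alph v → (M i).Γ (M i).k₀}
      {g : (M i).Γ (M i).k₁ → alph v'} {U : ∀ v, List (alph v)} {L : List ((M i).Γ (M i).k₁)} :
      Exec (M i).m s (initList (M i) ((U v).reverse.map f)) (haltList (M i) L) →
      Runs (s + 2 * (U v).length + 2 * L.length + 2) (.call i v v' f g) U
        (update (update U v []) v' ((L.map g).reverse ++ update U v [] v'))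
  | mono {s t : ℕ} {p : Prog M alph} {U U' : ∀ v, List (alph v)} :
      Runs s p U U' → s ≤ t → Runs t p U U'

theorem Runs.move {v v' : V} (hv : v' ≠ v) (f : alph v → alph v') (U : ∀ v, List (alph v)) :
    Runs (2 * (U v).length + 1) (.move v v' f : Prog M alph) U
      (update (update U v []) v' (((U v).map f).reverse ++ U v')) := by
  generalize hL : U v = L
  induction L generalizing U with
  | nil =>
    have nothing : update (update U v []) v' (([].map f).reverse ++ U v') = U := by
      simp [← hL]
    rw [nothing]
    exact .loop_nil hL
  | cons a L ih =>
    have tail := ih (update (update U v L) v' (f a :: U v')) (by simp [hv.symm])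
    rw [update_comm hv, update_idem, update_idem, update_self] at tail
    have head := Runs.push (M := M) v' [f a] (update U v L)
    rw [update_of_ne hv] at head
    have whole := Runs.loop_cons (body := fun a => .push v' [f a]) hL head tail
    rw [List.map_cons, List.reverse_cons, List.append_assoc]
    exact whole.mono (by simp only [List.length_cons]; omega)

variable [DecidableEq I]

theorem stepAux_pushWord {Λ : Type} (v : V) (next : Λ) (w : List (alph v)) (s : Mem M Λ)
    (T : ∀ i k, List ((M i).Γ k)) (U : ∀ v, List (alph v)) :
    TM2.stepAux (pushWord v next w) s (join T U) =
      ⟨some next, s, join T (update U v (w.reverse ++ U v))⟩ := by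
  induction w generalizing U with
  | nil => simp [pushWord]
  | cons a w ih =>
    simp only [pushWord, TM2.stepAux, update_join_inr, ih]
    simp

theorem stepAux_popTo {Λ : Type} (k : Stk M V) (next : Option (StkAlph M alph k) → Λ)
    (s : Mem M Λ) (S : ∀ k, List (StkAlph M alph k)) :
    TM2.stepAux (popTo k next) s S =
      ⟨some (next (S k).head?), (s.1, next (S k).head?), update S k (S k).tail⟩ := rfl

/-- A configuration of a machine that calls the machines `M i`, at a time when none of these is
running: they are in their initial states, and their stacks are empty. -/
def idleCfg {Λ : Type} (l r : Λ) (U : ∀ v, List (alph v)) :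
    TM2.Cfg (StkAlph M alph) Λ (Mem M Λ) :=
  ⟨some l, (fun i => (M i).initialState, r), join (fun _ _ => []) U⟩

section Call

variable {Λ : Type} {m : Λ → TM2.Stmt (StkAlph M alph) Λ (Mem M Λ)} {i : I} {v v' : V}
  {f : alph v → (M i).Γ (M i).k₀} {g : (M i).Γ (M i).k₁ → alph v'}
  {φ : CallLabel (alph v) (M i).Λ ((M i).Γ (M i).k₁) → Λ} {exit : Λ}

theorem exec_load (hm : ∀ l, m (φ l) = callStmt f g φ exit l)
    (s : ∀ i, (M i).σ) (r : Λ) (T : ∀ i k, List ((M i).Γ k)) (U : ∀ v, List (alph v)) :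
    Exec m (2 * (U v).length + 1) ⟨some (φ .load), (s, r), join T U⟩
      ⟨some (φ (.run (M i).main)), (s, φ (.run (M i).main)),
        join (update T i (update (T i) (M i).k₀ (((U v).reverse.map f) ++ T i (M i).k₀)))
          (update U v [])⟩ := by
  generalize hL : U v = L
  induction L generalizing r T U with
  | nil =>
    refine .step ?_
    rw [hm, callStmt, stepAux_popTo]
    simp [hL, update_join_inr, Exec.refl]
  | cons a L ih =>
    change Exec m (2 * L.length + 1 + 1 + 1) _ _
    refine .step ?_
    rw [hm, callStmt, stepAux_popTo, join_inr, hL]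
    refine .step ?_
    simp only [List.head?_cons, Option.elim_some, hm, callStmt, TM2.stepAux, List.tail_cons,
      update_join_inr, update_join_inl, join_inl]
    simpa using ih (φ (.loadPush a)) (update T i (update (T i) (M i).k₀ (f a :: T i (M i).k₀)))
      (update U v L) (by simp)

theorem exec_store (hm : ∀ l, m (φ l) = callStmt f g φ exit l)
    (s : ∀ i, (M i).σ) (r : Λ) (T : ∀ i k, List ((M i).Γ k)) (U : ∀ v, List (alph v)) :
    Exec m (2 * (T i (M i).k₁).length + 1) ⟨some (φ .store), (s, r), join T U⟩
      ⟨some exit, (s, exit), join (update T i (update (T i) (M i).k₁ []))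
        (update U v' (((T i (M i).k₁).map g).reverse ++ U v'))⟩ := by
  generalize hL : T i (M i).k₁ = L
  induction L generalizing r T U with
  | nil =>
    refine .step ?_
    rw [hm, callStmt, stepAux_popTo]
    simp [hL, update_join_inl, Exec.refl]
  | cons a L ih =>
    change Exec m (2 * L.length + 1 + 1 + 1) _ _
    refine .step ?_
    rw [hm, callStmt, stepAux_popTo, join_inl, hL]
    refine .step ?_
    simp only [List.head?_cons, Option.elim_some, hm, callStmt, TM2.stepAux, List.tail_cons,
      update_join_inr, update_join_inl, join_inr]
    simpa using ih (φ (.storePush a)) (update T i (update (T i) (M i).k₁ L))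
      (update U v' (g a :: U v')) (by simp)

theorem initList_eq (tm : FinTM2) (L : List (tm.Γ tm.k₀)) :
    initList tm L = ⟨some tm.main, tm.initialState, update (fun _ => []) tm.k₀ L⟩ := by
  unfold initList
  congr 1
  funext k
  obtain rfl | h := eq_or_ne k tm.k₀
  · simp
  · simp [h]

theorem haltList_eq (tm : FinTM2) (L : List (tm.Γ tm.k₁)) :
    haltList tm L = ⟨none, tm.initialState, update (fun _ => []) tm.k₁ L⟩ := by
  unfold haltList
  congr 1
  funext k
  obtain rfl | h := eq_or_ne k tm.k₁
  · simp
  · simp [h]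

theorem exec_call (hm : ∀ l, m (φ l) = callStmt f g φ exit l) {t : ℕ} (r : Λ)
    (U : ∀ v, List (alph v)) {L : List ((M i).Γ (M i).k₁)}
    (h : Exec (M i).m t (initList (M i) ((U v).reverse.map f)) (haltList (M i) L)) :
    Exec m (t + 2 * (U v).length + 2 * L.length + 2) (idleCfg (φ .load) r U)
      (idleCfg exit exit (update (update U v []) v' ((L.map g).reverse ++ update U v [] v'))) := by
  have load := exec_load hm (fun i => (M i).initialState) r (fun _ _ => []) U
  have run := h.embed (m := m) (φ := fun l => φ (.run l)) (fun l => hm (.run l))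
    (fun i => (M i).initialState) (φ (.run (M i).main)) (fun _ _ => []) (update U v [])
  have store := exec_store hm (fun i => (M i).initialState) (φ (.run (M i).main))
    (update (fun _ _ => []) i (update (fun _ => []) (M i).k₁ L)) (update U v [])
  have stack_cleared : update (fun _ => []) (M i).k₁ [] = fun k => ([] : List ((M i).Γ k)) :=
    update_eq_self _ _
  have machine_cleared : update (fun _ _ => []) i (fun _ => []) =
      fun i k => ([] : List ((M i).Γ k)) := update_eq_self _ _
  simp only [initList_eq, haltList_eq, embedCfg, Option.elim, update_eq_self] at run
  simp only [List.append_nil] at load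
  simp only [update_self, update_idem, stack_cleared, machine_cleared] at store
  exact ((load.trans run).trans store).mono (by omega)

end Call

theorem Runs.exec {Λ : Type} {m : Λ → TM2.Stmt (StkAlph M alph) Λ (Mem M Λ)} {t : ℕ}
    {p : Prog M alph} {U U' : ∀ v, List (alph v)} (h : Runs t p U U') {φ : p.Label → Λ} {exit : Λ}
    (hm : ∀ l, m (φ l) = p.compile φ exit l) (r : Λ) :
    ∃ r', Exec m t (idleCfg (φ p.entry) r U) (idleCfg exit r' U') := by
  induction h generalizing exit r with
  | push v w U =>
    refine ⟨r, .step ?_⟩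
    rw [hm, Prog.compile, stepAux_pushWord]
    exact .refl _ _
  | @seq s t p q _ _ _ _ _ ihp ihq =>
    obtain ⟨r₁, h₁⟩ := ihp (fun l => hm (.inl l)) r
    obtain ⟨r₂, h₂⟩ := ihq (fun l => hm (.inr l)) r₁
    exact ⟨r₂, h₁.trans h₂⟩
  | @loop_nil v body U hU =>
    refine ⟨exit, .step ?_⟩
    rw [hm, Prog.entry, Prog.compile, stepAux_popTo]
    simp only [join_inr, hU, List.head?_nil, Option.elim_none, update_join_inr, List.tail_nil]
    rw [← hU, update_eq_self]
    exact .refl _ _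
  | @loop_cons s t v body _ _ _ a L hU _ _ ihb ihl =>
    obtain ⟨r₁, h₁⟩ := ihb (fun l => hm (some ⟨a, l⟩)) (φ (some ⟨a, (body a).entry⟩))
    obtain ⟨r₂, h₂⟩ := ihl hm r₁
    refine ⟨r₂, .step ?_⟩
    rw [hm, Prog.entry, Prog.compile, stepAux_popTo, join_inr, hU, List.head?_cons,
      Option.elim_some, List.tail_cons, update_join_inr]
    exact h₁.trans h₂
  | call h => exact ⟨exit, exec_call hm r _ h⟩
  | mono _ hst ih =>
    obtain ⟨r', h⟩ := ih hm r
    exact ⟨r', h.mono hst⟩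

end Prog

/-! ### Polynomial time in terms of bounded executions -/

/-- The machine `c` maps the word `L` to the word `L'` in at most `t` steps. -/
def Outputs {Γ₁ Γ₂ : Type} (c : TM2ComputableAux Γ₁ Γ₂) (L : List Γ₁) (L' : List Γ₂) (t : ℕ) :
    Prop :=
  Exec c.tm.m t (initList c.tm (L.map c.inputAlphabet.symm))
    (haltList c.tm (L'.map c.outputAlphabet.symm))

theorem eval_mono (p : Polynomial ℕ) {m n : ℕ} (h : m ≤ n) : p.eval m ≤ p.eval n := by
  simp only [Polynomial.eval_eq_sum_range]
  gcongr

section PolyTime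

variable {α β Γ₁ Γ₂ : Type} {ea : α → List Γ₁} {eb : β → List Γ₂} {f : α → β}

theorem polyTime_iff : PolyTime ea eb f ↔
    ∃ (c : TM2ComputableAux Γ₁ Γ₂) (p : Polynomial ℕ),
      ∀ a, Outputs c (ea a) (eb (f a)) (p.eval (ea a).length) := by
  constructor
  · rintro ⟨h⟩
    exact ⟨h.toTM2ComputableAux, h.time, fun a => exec_iff.2 ⟨h.outputsFun a⟩⟩
  · rintro ⟨c, p, h⟩
    exact ⟨⟨c, p, fun a => (exec_iff.1 (h a)).some⟩⟩

theorem Outputs.exists_length_le (c : TM2ComputableAux Γ₁ Γ₂) :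
    ∃ b, ∀ L L' t, Outputs c L L' t → L'.length ≤ L.length + b * t := by
  let := c.tm.ΛFin
  refine ⟨∑ l, pushCount (c.tm.m l), fun L L' t h => ?_⟩
  have pushes (l : c.tm.Λ) : pushCount (c.tm.m l) ≤ ∑ l, pushCount (c.tm.m l) :=
    Finset.single_le_sum (f := fun l => pushCount (c.tm.m l)) (fun _ _ => Nat.zero_le _)
      (Finset.mem_univ l)
  have input (k : c.tm.K) (w : List (c.tm.Γ c.tm.k₀)) :
      (update (fun _ => []) c.tm.k₀ w k).length ≤ w.length := by
    obtain rfl | e := eq_or_ne k c.tm.k₀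
    · simp
    · simp [e]
  unfold Outputs at h
  rw [initList_eq, haltList_eq] at h
  have growth := h.length_le pushes c.tm.k₁
  simp only [update_self, List.length_map] at growth
  have start := input c.tm.k₁ (L.map c.inputAlphabet.symm)
  rw [List.length_map] at start
  exact growth.trans (Nat.add_le_add_right start _)

theorem PolyTime.exists_length_le (h : PolyTime ea eb f) :
    ∃ q : Polynomial ℕ, ∀ a, (eb (f a)).length ≤ q.eval (ea a).length := by
  obtain ⟨c, p, h⟩ := polyTime_iff.1 h
  obtain ⟨b, hb⟩ := Outputs.exists_length_le c
  refine ⟨Polynomial.X + Polynomial.C b * p, fun a => ?_⟩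
  simpa using hb _ _ _ (h a)

theorem PolyTime.of_runs {I V : Type} [DecidableEq V] [Finite I] [Finite V]
    {M : I → FinTM2} {alph : V → Type} [∀ v, Finite (alph v)] [∀ i, Finite ((M i).Γ (M i).k₁)]
    {vin vout : V} {ea : α → List (alph vin)} {eb : β → List (alph vout)} (p : Prog M alph)
    (q : Polynomial ℕ) (h : ∀ a, Runs (q.eval (ea a).length) p
      (update (fun _ => []) vin (ea a)) (update (fun _ => []) vout (eb (f a)))) :
    PolyTime ea eb f := by
  classical
  have := p.finite_label
  have := fun i => (M i).σFin
  have := fun i => (M i).kFin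
  let tm : FinTM2 := {
    K := Stk M V
    kFin := Fintype.ofFinite _
    k₀ := .inr vin
    k₁ := .inr vout
    Γ := StkAlph M alph
    Λ := Option p.Label
    main := some p.entry
    ΛFin := Fintype.ofFinite _
    σ := Mem M (Option p.Label)
    initialState := (fun i => (M i).initialState, none)
    σFin := Fintype.ofFinite _
    Γk₀Fin := Fintype.ofFinite (alph vin)
    m := fun l => l.elim (.load (fun s => (s.1, none)) .halt) (p.compile some none) }
  refine polyTime_iff.2 ⟨⟨tm, Equiv.refl _, Equiv.refl _⟩, q + 1, fun a => ?_⟩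
  have empty : (fun _ => []) = join (fun i k => ([] : List ((M i).Γ k)))
      fun v => ([] : List (alph v)) := by
    funext k
    cases k <;> rfl
  obtain ⟨r, run⟩ := (h a).exec (m := tm.m) (φ := some) (exit := none) (fun _ => rfl) none
  have halt : Exec tm.m 1 (idleCfg none r (update (fun _ => []) vout (eb (f a))))
    ⟨none, tm.initialState, join (fun _ _ => []) (update (fun _ => []) vout (eb (f a)))⟩ :=
    .step (.refl _ _)
  have whole := run.trans halt
  rw [idleCfg, ← update_join_inr, ← update_join_inr, ← empty] at whole
  unfold Outputs
  rw [initList_eq, haltList_eq, Polynomial.eval_add, Polynomial.eval_one]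
  change Exec tm.m _ ⟨_, _, update _ (Sum.inr vin) ((ea a).map id)⟩
    ⟨_, _, update _ (Sum.inr vout) ((eb (f a)).map id)⟩
  rw [List.map_id, List.map_id]
  exact whole

end PolyTime

/-! ### Programs on five stacks -/

/-- Names for five stacks: one for the input, three for intermediate results, one for the output. -/
inductive Reg : Type
  | inp | a | b | c | out
  deriving DecidableEq

instance : Finite Reg :=
  .of_surjective (fun i : Fin 5 => [Reg.inp, .a, .b, .c, .out].get i) fun r => by
    cases r <;> decide

section Reg

variable {A B C D E : Type}

/-- The alphabets of the five stacks. -/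
abbrev Reg.alph (A B C D E : Type) : Reg → Type
  | .inp => A
  | .a => B
  | .b => C
  | .c => D
  | .out => E

instance [Finite A] [Finite B] [Finite C] [Finite D] [Finite E] (r : Reg) :
    Finite (Reg.alph A B C D E r) := by
  cases r <;> assumption

/-- The contents of the five stacks. -/
def regs (i : List A) (a : List B) (b : List C) (c : List D) (o : List E) :
    ∀ r, List (Reg.alph A B C D E r)
  | .inp => i
  | .a => a
  | .b => b
  | .c => c
  | .out => o

variable (i : List A) (a : List B) (b : List C) (c : List D) (o : List E)

@[simp] theorem regs_inp : regs i a b c o .inp = i := rfl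

@[simp] theorem regs_a : regs i a b c o .a = a := rfl

@[simp] theorem regs_b : regs i a b c o .b = b := rfl

@[simp] theorem regs_c : regs i a b c o .c = c := rfl

@[simp] theorem regs_out : regs i a b c o .out = o := rfl

@[simp]
theorem update_regs_inp (L : List A) : update (regs i a b c o) .inp L = regs L a b c o := by
  funext r; cases r <;> rfl

@[simp]
theorem update_regs_a (L : List B) : update (regs i a b c o) .a L = regs i L b c o := by
  funext r; cases r <;> rfl

@[simp]
theorem update_regs_b (L : List C) : update (regs i a b c o) .b L = regs i a L c o := by
  funext r; cases r <;> rfl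

@[simp]
theorem update_regs_c (L : List D) : update (regs i a b c o) .c L = regs i a b L o := by
  funext r; cases r <;> rfl

@[simp]
theorem update_regs_out (L : List E) : update (regs i a b c o) .out L = regs i a b c L := by
  funext r; cases r <;> rfl

theorem PolyTime.of_runs_regs [Finite A] [Finite B] [Finite C] [Finite D] [Finite E] {I : Type}
    [Finite I] {X Y : I → Type} [∀ i, Finite (Y i)] (m : ∀ i, TM2ComputableAux (X i) (Y i))
    {α β : Type} {ea : α → List A} {eb : β → List E} {f : α → β}
    (p : Prog (fun i => (m i).tm) (Reg.alph A B C D E))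
    (q : Polynomial ℕ) (h : ∀ x, Runs (q.eval (ea x).length) p
      (regs (ea x) [] [] [] []) (regs [] [] [] [] (eb (f x)))) :
    PolyTime ea eb f := by
  have (i : I) : Finite ((m i).tm.Γ (m i).tm.k₁) := .of_equiv _ (m i).outputAlphabet.symm
  have empty : (fun _ => []) =
      regs ([] : List A) ([] : List B) ([] : List C) ([] : List D) ([] : List E) := by
    funext r; cases r <;> rfl
  refine PolyTime.of_runs (vin := .inp) (vout := .out) p q fun x => ?_
  rw [empty, update_regs_inp, update_regs_out]
  exact h x

end Reg

theorem Runs.loop {I V : Type} [DecidableEq V] {M : I → FinTM2} {alph : V → Type} {t : ℕ} {v : V}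
    {body : alph v → Prog M alph} (L : List (alph v)) (S : ℕ → ∀ v, List (alph v))
    (h : ∀ i (hi : i < L.length), Runs t (body L[i]) (update (S i) v (L.drop (i + 1)))
      (update (S (i + 1)) v (L.drop (i + 1)))) :
    Runs (L.length * (t + 1) + 1) (.loop v body) (update (S 0) v L) (update (S L.length) v []) := by
  induction L generalizing S with
  | nil => simpa using Runs.loop_nil (update_self v [] (S 0))
  | cons a L ih =>
    have head := h 0 (Nat.succ_pos _)
    have tail := ih (fun i => S (i + 1)) fun i hi => h (i + 1) (Nat.succ_lt_succ hi)
    have whole := Runs.loop_cons (body := body) (update_self v (a :: L) (S 0))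
      (by simpa using head) tail
    exact whole.mono (by rw [List.length_cons]; linarith)

theorem Runs.loop_singleton {I V : Type} [DecidableEq V] {M : I → FinTM2} {alph : V → Type} {t : ℕ}
    {v : V} {a : alph v} {body : alph v → Prog M alph} {U U' : ∀ v, List (alph v)} (hU : U v = [a])
    (h : Runs t (body a) (update U v []) U') (hU' : U' v = []) :
    Runs (t + 2) (.loop v body) U U' :=
  .loop_cons hU h (.loop_nil hU')

theorem Runs.push_of_eq {I V : Type} [DecidableEq V] {M : I → FinTM2} {alph : V → Type} {v : V}
    {w : List (alph v)} {U U' : ∀ v, List (alph v)} (h : update U v (w.reverse ++ U v) = U') :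
    Runs (M := M) 1 (.push v w) U U' :=
  h ▸ .push v w U

theorem Runs.move_of_eq {I V : Type} [DecidableEq V] {M : I → FinTM2} {alph : V → Type} {t : ℕ}
    {v v' : V} (hv : v' ≠ v) {f : alph v → alph v'} {U U' : ∀ v, List (alph v)}
    (h : update (update U v []) v' (((U v).map f).reverse ++ U v') = U')
    (ht : 2 * (U v).length + 1 ≤ t) : Runs (M := M) t (.move v v' f) U U' :=
  h ▸ (Runs.move hv f U).mono ht

/-! ### Finite-state transducers -/

/-- A finite-state transducer: a finite automaton that outputs a word with each symbol that it reads
and one more word, which depends on its final state, at the end. -/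
structure Transducer (A B Q : Type) where
  start : Q
  next : Q → A → Q
  out : Q → A → List B
  final : Q → List B

namespace Transducer

variable {A B Q : Type} (T : Transducer A B Q)

/-- The output of a transducer while it reads a word, beginning in a given state. -/
def scan : Q → List A → List B
  | _, [] => []
  | q, a :: L => T.out q a ++ scan (T.next q a) L

/-- The output of a transducer on a word. -/
def run (L : List A) : List B :=
  T.scan T.start L ++ T.final (L.foldl T.next T.start)

theorem scan_append (q : Q) (L L' : List A) :
    T.scan q (L ++ L') = T.scan q L ++ T.scan (L.foldl T.next q) L' := by
  induction L generalizing q with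
  | nil => rfl
  | cons a L ih => simp [scan, ih]

theorem scan_of_next_eq {q : Q} {L : List A} (h : ∀ a ∈ L, T.next q a = q) :
    T.scan q L = L.flatMap (T.out q) := by
  induction L with
  | nil => rfl
  | cons a L ih =>
    rw [List.forall_mem_cons] at h
    rw [scan, h.1, ih h.2, List.flatMap_cons]

theorem foldl_next_of_next_eq {q : Q} {L : List A} (h : ∀ a ∈ L, T.next q a = q) :
    L.foldl T.next q = q := by
  induction L with
  | nil => rfl
  | cons a L ih =>
    rw [List.forall_mem_cons] at h
    rw [List.foldl_cons, h.1, ih h.2]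

theorem length_scan_le {n : ℕ} (hn : ∀ q a, (T.out q a).length ≤ n) (q : Q) (L : List A) :
    (T.scan q L).length ≤ n * L.length := by
  induction L generalizing q with
  | nil => simp [scan]
  | cons a L ih =>
    rw [scan, List.length_append, List.length_cons, Nat.mul_succ, Nat.add_comm]
    exact Nat.add_le_add (ih _) (hn q a)

variable {I : Type} {M : I → FinTM2}

/-- The program that reads the symbol `x`. The state is stored on the stack `.a`, the reversed
output is collected on `.c`, and `.b` is a buffer for the new state. -/
def stepProg (x : A) : Prog M (Reg.alph A Q Q B B) :=
  .seq (.loop .a fun q => .seq (.push .c (T.out q x)) (.push .b [T.next q x])) (.move .b .a id)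

/-- The program of a transducer. -/
def prog : Prog M (Reg.alph A Q Q B B) :=
  .seq (.push .a [T.start]) <| .seq (.loop .inp T.stepProg) <|
    .seq (.loop .a fun q => .push .c (T.final q)) (.move .c .out id)

theorem runs_stepProg (q : Q) (x : A) (L : List A) (w o : List B) :
    Runs 7 (T.stepProg x : Prog M _) (regs L [q] [] w o)
      (regs L [T.next q x] [] ((T.out q x).reverse ++ w) o) := by
  refine Runs.seq (s := 2 + 2) (t := 3)
    (U' := regs L [] [T.next q x] ((T.out q x).reverse ++ w) o) ?_ ?_
  · exact .loop_singleton rfl (.seq (.push _ _ _) (.push_of_eq (by simp))) rfl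
  · exact .move_of_eq (by decide) (by simp) (by simp)

theorem runs_prog (L : List A) : Runs (8 * L.length + 2 * (T.run L).length + 6)
    (T.prog : Prog M _) (regs L [] [] [] []) (regs [] [] [] [] (T.run L)) := by
  let state (i : ℕ) := regs ([] : List A) [(L.take i).foldl T.next T.start] ([] : List Q)
    (T.scan T.start (L.take i)).reverse ([] : List B)
  have scan := Runs.loop (v := .inp) (body := T.stepProg (M := M)) L state fun i hi => by
    simp only [state, update_regs_inp, List.take_succ_eq_append_getElem hi, scan_append,
      List.foldl_append]
    simpa [Transducer.scan] using T.runs_stepProg _ L[i] _ _ _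
  simp only [state, update_regs_inp, List.take_length] at scan
  refine (Runs.seq (s := 1) (U' := regs L [T.start] [] [] []) (.push_of_eq (by simp))
    (scan.seq (.seq (s := 3) (t := 2 * (T.run L).length + 1)
      (U' := regs [] [] [] (T.run L).reverse []) ?_ ?_))).mono (by linarith)
  · exact .loop_singleton rfl (.push_of_eq (by simp [run])) rfl
  · exact .move_of_eq (by decide) (by simp) (by simp)

end Transducer

theorem PolyTime.transduce {α β A B Q : Type} [Finite A] [Finite B] [Finite Q] {ea : α → List A}
    {eb : β → List B} {f : α → β} (T : Transducer A B Q) (h : ∀ x, eb (f x) = T.run (ea x)) :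
    PolyTime ea eb f := by
  have := Nonempty.intro T.start
  obtain ⟨n, hn⟩ := Finite.exists_le fun p : Q × A => (T.out p.1 p.2).length
  obtain ⟨n', hn'⟩ := Finite.exists_le fun q => (T.final q).length
  refine PolyTime.of_runs_regs (X := fun _ : Empty => Unit) (Y := fun _ => Unit) Empty.rec T.prog
    (Polynomial.C (8 + 2 * n) * Polynomial.X + Polynomial.C (2 * n' + 6)) fun x => ?_
  rw [h]
  refine (T.runs_prog (ea x)).mono ?_
  have scan := T.length_scan_le (fun q a => hn (q, a)) T.start (ea x)
  have final := hn' ((ea x).foldl T.next T.start)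
  simp only [Transducer.run, List.length_append, Polynomial.eval_add, Polynomial.eval_mul,
    Polynomial.eval_C, Polynomial.eval_X]
  linarith

/-! ### Composition, pairing and iteration -/

/-- The program that calls the `i`-th machine on the contents of `v`, from bottom to top and mapped
by `f`, and pushes the output, mapped by `g`, on `v'`. -/
def Prog.apply {I V : Type} {X Y : I → Type} (m : ∀ i, TM2ComputableAux (X i) (Y i))
    {alph : V → Type} (i : I) (v v' : V) (f : alph v → X i) (g : Y i → alph v') :
    Prog (fun i => (m i).tm) alph :=
  .call i v v' (fun a => (m i).inputAlphabet.symm (f a)) fun b => g ((m i).outputAlphabet b)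

theorem Runs.apply {I V : Type} [DecidableEq V] {X Y : I → Type}
    (m : ∀ i, TM2ComputableAux (X i) (Y i)) {alph : V → Type} {i : I} {v v' : V}
    {f : alph v → X i} {g : Y i → alph v'} {U U' : ∀ v, List (alph v)} {L : List (X i)}
    {L' : List (Y i)} {t : ℕ} (h : Outputs (m i) L L' t) (hU : (U v).reverse.map f = L)
    (hU' : update (update U v []) v' ((L'.map g).reverse ++ update U v [] v') = U') :
    Runs (t + 2 * L.length + 2 * L'.length + 2) (.apply m i v v' f g) U U' := by
  subst hU hU'
  rw [Outputs, List.map_map] at h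
  have call := Runs.call (M := fun i => (m i).tm) (v' := v')
    (g := fun b => g ((m i).outputAlphabet b)) h
  simpa [Function.comp_def, Prog.apply] using call

section Comp

variable {α β γ A B C : Type} {ea : α → List A} {eb : β → List B} {ec : γ → List C}

theorem PolyTime.comp [Finite A] [Finite B] [Finite C] {g : β → γ} {f : α → β}
    (hg : PolyTime eb ec g) (hf : PolyTime ea eb f) : PolyTime ea ec fun a => g (f a) := by
  obtain ⟨q, hq⟩ := hf.exists_length_le
  obtain ⟨r, hr⟩ := hg.exists_length_le
  obtain ⟨c₁, p₁, h₁⟩ := polyTime_iff.1 hf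
  obtain ⟨c₂, p₂, h₂⟩ := polyTime_iff.1 hg
  let m : ∀ i, TM2ComputableAux (cond i B A) (cond i C B) := fun i => match i with
    | false => c₁
    | true => c₂
  have (i : Bool) : Finite (cond i C B) := by cases i <;> assumption
  refine PolyTime.of_runs_regs m (C := B) (B := A) (D := C)
    (.seq (.move .inp .a id) <| .seq (.apply m false .a .b id id) <|
      .seq (.apply m true .b .c id id) (.move .c .out id))
    (4 * Polynomial.X + 4 * q + 4 * r.comp q + p₁ + p₂.comp q + 6) fun x => ?_
  refine Runs.mono (.seq (s := 2 * (ea x).length + 1) (U' := regs [] (ea x).reverse [] [] [])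
    (.move_of_eq (by decide) (by simp) (by simp))
    (.seq (U' := regs [] [] (eb (f x)).reverse [] []) (.apply m (h₁ x) (by simp) (by simp))
    (.seq (U' := regs [] [] [] (ec (g (f x))).reverse [])
      (.apply m (h₂ (f x)) (by simp) (by simp))
    (.move_of_eq (by decide) (by simp) le_rfl)))) ?_
  have := hq x
  have := (hr (f x)).trans (eval_mono r (hq x))
  have := eval_mono p₂ (hq x)
  simp only [regs_c, List.length_reverse, Polynomial.eval_add, Polynomial.eval_mul,
    Polynomial.eval_comp, Polynomial.eval_X, Polynomial.eval_ofNat]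
  linarith

/-- The code of a pair, over the sum of the two alphabets. -/
def prodEnc (ea : α → List A) (eb : β → List B) (x : α × β) : List (A ⊕ B) :=
  (ea x.1).map .inl ++ (eb x.2).map .inr

theorem unaryEncodeNat_eq_replicate (n : ℕ) : unaryEncodeNat n = List.replicate n true := by
  induction n with
  | zero => rfl
  | succ n ih => rw [unaryEncodeNat, ih, List.replicate_succ]

theorem length_unaryEncodeNat (n : ℕ) : (unaryEncodeNat n).length = n := by
  rw [unaryEncodeNat_eq_replicate, List.length_replicate]

theorem PolyTime.pair [Finite A] [Finite B] [Finite C] {f : α → β} {g : α → γ}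
    (hf : PolyTime ea eb f) (hg : PolyTime ea ec g) :
    PolyTime ea (prodEnc eb ec) fun a => (f a, g a) := by
  obtain ⟨q, hq⟩ := hf.exists_length_le
  obtain ⟨r, hr⟩ := hg.exists_length_le
  obtain ⟨c₁, p₁, h₁⟩ := polyTime_iff.1 hf
  obtain ⟨c₂, p₂, h₂⟩ := polyTime_iff.1 hg
  let m : ∀ i, TM2ComputableAux A (cond i C B) := fun i => match i with
    | false => c₁
    | true => c₂
  have (i : Bool) : Finite (cond i C B) := by cases i <;> assumption
  refine PolyTime.of_runs_regs m (B := A) (C := A) (D := B ⊕ C)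
    (.seq (.loop .inp fun x => .seq (.push .a [x]) (.push .b [x])) <|
      .seq (.apply m false .a .c id .inl) <| .seq (.apply m true .b .c id .inr) (.move .c .out id))
    (7 * Polynomial.X + 4 * q + 4 * r + p₁ + p₂ + 6) fun x => ?_
  have copy := Runs.loop (M := fun i => (m i).tm) (v := .inp)
    (body := fun x => .seq (.push .a [x]) (.push .b [x])) (ea x)
    (fun i => regs ([] : List A) ((ea x).take i).reverse ((ea x).take i).reverse
      ([] : List (B ⊕ C)) ([] : List (B ⊕ C)))
    fun i hi => by
      rw [List.take_succ_eq_append_getElem hi]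
      exact .seq (.push _ _ _) (.push_of_eq (by simp [-List.take_append_getElem]))
  refine Runs.mono (.seq (by simpa using copy)
    (.seq (U' := regs [] [] (ea x).reverse ((eb (f x)).map .inl).reverse [])
      (.apply m (h₁ x) (by simp) (by simp))
    (.seq (U' := regs [] [] [] (prodEnc eb ec (f x, g x)).reverse [])
      (.apply m (h₂ x) (by simp)
        (by simp only [update_regs_b, update_regs_c, regs_c, prodEnc, List.reverse_append]))
    (.move_of_eq (by decide) (by simp) le_rfl)))) ?_
  have := hq x
  have := hr x
  simp only [regs_c, prodEnc, List.length_reverse, List.length_append, List.length_map,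
    Polynomial.eval_add, Polynomial.eval_mul, Polynomial.eval_X, Polynomial.eval_ofNat]
  linarith

theorem runs_iterate {f : α → α} {m : TM2ComputableAux A A} {p : Polynomial ℕ}
    (h : ∀ x, Outputs m (ea x) (ea (f x)) (p.eval (ea x).length)) {n l : ℕ} {x : α}
    (hl : ∀ i ≤ n, (ea (f^[i] x)).length ≤ l) (o : List A) :
    Runs (n * (p.eval l + 4 * l + 3) + 1)
      (.loop .a fun _ => .apply (fun _ : Unit => m) () .b .b id id)
      (regs ([] : List (Bool ⊕ A)) (List.replicate n true) (ea x).reverse ([] : List Unit) o)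
      (regs [] [] (ea (f^[n] x)).reverse [] o) := by
  have whole := Runs.loop (M := fun _ : Unit => m.tm) (v := Reg.a) (t := p.eval l + 4 * l + 2)
    (body := fun _ => .apply (fun _ : Unit => m) () .b .b id id) (List.replicate n true)
    (fun i => regs ([] : List (Bool ⊕ A)) [] (ea (f^[i] x)).reverse ([] : List Unit) o)
    fun i hi => by
      rw [List.length_replicate] at hi
      have := hl i hi.le
      have := eval_mono p (hl i hi.le)
      have := hl (i + 1) hi
      rw [iterate_succ_apply'] at this ⊢
      exact (Runs.apply _ (h (f^[i] x)) (by simp) (by simp)).mono (by linarith)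
  simpa using whole

theorem PolyTime.iterate_of_code [Finite A] {f : α → α} (hf : PolyTime ea ea f) (n : γ → ℕ)
    (s : γ → α) (q : Polynomial ℕ) (hq : ∀ c, ∀ i ≤ n c, (ea (f^[i] (s c))).length ≤
      q.eval (prodEnc unaryEncodeNat ea (n c, s c)).length) :
    PolyTime (fun c => prodEnc unaryEncodeNat ea (n c, s c)) ea fun c => f^[n c] (s c) := by
  obtain ⟨m, p, h⟩ := polyTime_iff.1 hf
  refine PolyTime.of_runs_regs (fun _ : Unit => m) (B := Bool) (C := A) (D := Unit)
    (.seq (.loop .inp (Sum.elim (fun b => .push .a [b]) fun x => .push .b [x])) <|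
      .seq (.loop .a fun _ => .apply _ () .b .b id id) (.move .b .out id))
    (2 * Polynomial.X + Polynomial.X * (p.comp q + 4 * q + 3) + 2 * q + 3) fun c => ?_
  let L := prodEnc unaryEncodeNat ea (n c, s c)
  have split := Runs.loop (M := fun _ : Unit => m.tm) (v := .inp) (t := 1)
    (body := Sum.elim (fun b => .push .a [b]) fun x => .push .b [x]) L
    (fun i => regs ([] : List (Bool ⊕ A)) ((L.take i).filterMap Sum.getLeft?).reverse
      ((L.take i).filterMap Sum.getRight?).reverse ([] : List Unit) ([] : List A))
    fun i hi => by
      rw [List.take_succ_eq_append_getElem hi]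
      rcases L[i] with b | x
      · exact .push_of_eq (by simp [List.filterMap_cons])
      · exact .push_of_eq (by simp [List.filterMap_cons])
  have left : L.filterMap Sum.getLeft? = List.replicate (n c) true := by
    simp [L, prodEnc, unaryEncodeNat_eq_replicate, -List.map_replicate, List.filterMap_map,
      Function.comp_def]
  have right : L.filterMap Sum.getRight? = ea (s c) := by
    simp [L, prodEnc, List.filterMap_map, Function.comp_def]
  simp only [List.take_zero, List.filterMap_nil, List.reverse_nil, update_regs_inp,
    List.take_length, left, right, List.reverse_replicate] at split
  refine (split.seq (.seq (runs_iterate h (hq c) []) (.move_of_eq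
    (t := 2 * (ea (f^[n c] (s c))).length + 1) (by decide) (by simp) (by simp)))).mono ?_
  have hn : n c ≤ L.length := by simp [L, prodEnc, length_unaryEncodeNat]
  have := hq c (n c) le_rfl
  have := Nat.mul_le_mul_right (p.eval (q.eval L.length) + 4 * q.eval L.length + 3) hn
  simp only [Polynomial.eval_add, Polynomial.eval_mul, Polynomial.eval_comp, Polynomial.eval_X,
    Polynomial.eval_ofNat]
  linarith

end Comp

variable {α β γ A B C : Type} {ea : α → List A} {eb : β → List B} {ec : γ → List C}

/-! ### Basic polynomial-time functions -/

theorem PolyTime.recode {α' : Type} {ea' : α' → List A} {f : γ → α} {g : γ → α'}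
    (h : PolyTime ec ea f) (hfg : ∀ c, ea (f c) = ea' (g c)) : PolyTime ec ea' g := by
  obtain ⟨c, p, h⟩ := polyTime_iff.1 h
  exact polyTime_iff.2 ⟨c, p, fun a => hfg a ▸ h a⟩

theorem PolyTime.flatMap [Finite A] [Finite B] {f : α → β} (w : A → List B)
    (h : ∀ a, eb (f a) = (ea a).flatMap w) : PolyTime ea eb f := by
  let T : Transducer A B Unit := ⟨(), fun _ _ => (), fun _ => w, fun _ => []⟩
  exact .transduce T fun a => by
    rw [h, Transducer.run, T.scan_of_next_eq fun _ _ => rfl, List.append_nil]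

theorem PolyTime.of_code_eq [Finite A] {e : β → List A} {f : α → β} (h : ∀ a, e (f a) = ea a) :
    PolyTime ea e f :=
  .flatMap (fun a => [a]) fun a => by simp [h]

theorem PolyTime.id [Finite A] : PolyTime ea ea fun a => a :=
  .of_code_eq fun _ => rfl

theorem PolyTime.const [Finite A] [Finite B] (b : β) : PolyTime ea eb fun _ => b := by
  let T : Transducer A B Unit := ⟨(), fun _ _ => (), fun _ _ => [], fun _ => eb b⟩
  exact .transduce T fun a => by
    rw [Transducer.run, T.scan_of_next_eq fun _ _ => rfl, List.flatMap_eq_nil_iff.2 fun _ _ => rfl,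
      List.nil_append]

section Pair

variable [Finite A] [Finite B]

theorem PolyTime.fst : PolyTime (prodEnc ea eb) ea fun p => p.1 :=
  .flatMap (Sum.elim (fun a => [a]) fun _ => []) fun p => by
    simp [prodEnc, List.flatMap_append, List.flatMap_map]

theorem PolyTime.snd : PolyTime (prodEnc ea eb) eb fun p => p.2 :=
  .flatMap (Sum.elim (fun _ => []) fun b => [b]) fun p => by
    simp [prodEnc, List.flatMap_append, List.flatMap_map]

theorem PolyTime.left [Finite C] {f : γ → α × β} (h : PolyTime ec (prodEnc ea eb) f) :
    PolyTime ec ea fun c => (f c).1 :=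
  PolyTime.fst.comp h

theorem PolyTime.right [Finite C] {f : γ → α × β} (h : PolyTime ec (prodEnc ea eb) f) :
    PolyTime ec eb fun c => (f c).2 :=
  PolyTime.snd.comp h

end Pair

theorem PolyTime.bool₂ [Finite C] (F : Bool → Bool → Bool) {f g : γ → Bool}
    (hf : PolyTime ec encodeBool f) (hg : PolyTime ec encodeBool g) :
    PolyTime ec encodeBool fun c => F (f c) (g c) :=
  PolyTime.comp (g := fun p : Bool × Bool => F p.1 p.2)
    (.transduce (Q := Bool) ⟨false, fun q s => s.elim (fun b => b) fun _ => q,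
      fun q s => s.elim (fun _ => []) fun b => [F q b], fun _ => []⟩ fun _ => rfl) (hf.pair hg)

theorem PolyTime.not [Finite C] {f : γ → Bool} (hf : PolyTime ec encodeBool f) :
    PolyTime ec encodeBool fun c => !f c :=
  .bool₂ (fun b _ => !b) hf hf

/-- The transducer that selects the second or the third component of the code of a triple, according
to the Boolean in front. -/
def Transducer.ite (A : Type) : Transducer (Bool ⊕ (A ⊕ A)) A Bool where
  start := false
  next q := Sum.elim (fun b => b) fun _ => q
  out q := Sum.elim (fun _ => []) <|
    Sum.elim (fun a => if q then [a] else []) fun a => if q then [] else [a]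
  final _ := []

theorem PolyTime.ite [Finite A] [Finite C] {b : γ → Bool} {f g : γ → α}
    (hb : PolyTime ec encodeBool b) (hf : PolyTime ec ea f) (hg : PolyTime ec ea g) :
    PolyTime ec ea fun c => if b c then f c else g c := by
  refine PolyTime.comp (g := fun p : Bool × (α × α) => if p.1 then p.2.1 else p.2.2)
    (.transduce (.ite A) fun ⟨b, x, y⟩ => ?_) (hb.pair (hf.pair hg))
  have scan (b : Bool) : (Transducer.ite A).scan b ((prodEnc ea ea (x, y)).map .inr) =
      if b then ea x else ea y := by
    rw [Transducer.scan_of_next_eq _ (by simp [Transducer.ite])]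
    cases b <;> simp [Transducer.ite, prodEnc, List.flatMap_append, List.flatMap_map]
  refine (apply_ite ea (b = true) x y).trans ((scan b).symm.trans (List.append_nil _).symm)

/-! ### Polynomially bounded functions -/

/-- A numerical function is bounded by a polynomial in the length of the code of its argument. -/
def PolyBdd (ea : α → List A) (h : α → ℕ) : Prop :=
  ∃ p : Polynomial ℕ, ∀ a, h a ≤ p.eval (ea a).length

theorem PolyTime.bdd {f : α → β} (h : PolyTime ea eb f) : PolyBdd ea fun a => (eb (f a)).length :=
  h.exists_length_le

theorem PolyBdd.const (n : ℕ) : PolyBdd ea fun _ => n :=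
  ⟨Polynomial.C n, fun _ => by simp⟩

theorem PolyBdd.add {f g : α → ℕ} (hf : PolyBdd ea f) (hg : PolyBdd ea g) :
    PolyBdd ea fun a => f a + g a := by
  obtain ⟨p, hp⟩ := hf
  obtain ⟨q, hq⟩ := hg
  exact ⟨p + q, fun a => by simpa using Nat.add_le_add (hp a) (hq a)⟩

theorem PolyBdd.mul {f g : α → ℕ} (hf : PolyBdd ea f) (hg : PolyBdd ea g) :
    PolyBdd ea fun a => f a * g a := by
  obtain ⟨p, hp⟩ := hf
  obtain ⟨q, hq⟩ := hg
  exact ⟨p * q, fun a => by simpa using Nat.mul_le_mul (hp a) (hq a)⟩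

theorem PolyBdd.mono {f g : α → ℕ} (hf : PolyBdd ea f) (h : ∀ a, g a ≤ f a) : PolyBdd ea g := by
  obtain ⟨p, hp⟩ := hf
  exact ⟨p, fun a => (h a).trans (hp a)⟩

theorem PolyTime.bdd_unary {n : α → ℕ} (h : PolyTime ea unaryEncodeNat n) : PolyBdd ea n :=
  h.bdd.mono fun a => (length_unaryEncodeNat (n a)).ge

/-! ### Iteration -/

theorem length_prodEnc (p : α × β) :
    (prodEnc ea eb p).length = (ea p.1).length + (eb p.2).length := by
  simp [prodEnc]

theorem iterate_prodMk (f : γ → α → α) (c : γ) (a : α) (i : ℕ) :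
    (fun p : γ × α => (p.1, f p.1 p.2))^[i] (c, a) = (c, (f c)^[i] a) := by
  induction i with
  | zero => rfl
  | succ i ih => rw [iterate_succ_apply', ih, iterate_succ_apply']

theorem PolyTime.iterate [Finite A] [Finite C] {f : γ → α → α} {n : γ → ℕ} {s : γ → α} {b : γ → ℕ}
    (hf : PolyTime (prodEnc ec ea) ea fun p => f p.1 p.2) (hn : PolyTime ec unaryEncodeNat n)
    (hs : PolyTime ec ea s) (hb : PolyBdd ec b)
    (h : ∀ c, ∀ i ≤ n c, (ea ((f c)^[i] (s c))).length ≤ b c) :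
    PolyTime ec ea fun c => (f c)^[n c] (s c) := by
  obtain ⟨p, hp⟩ := hb
  have run := PolyTime.iterate_of_code (ea := prodEnc ec ea) (f := fun p => (p.1, f p.1 p.2))
    (PolyTime.fst.pair hf) n (fun c => (c, s c)) (Polynomial.X + p) fun c i hi => by
      simp only [iterate_prodMk, length_prodEnc, Polynomial.eval_add, Polynomial.eval_X]
      have := (h c i hi).trans ((hp c).trans (eval_mono p
        (n := (unaryEncodeNat (n c)).length + ((ec c).length + (ea (s c)).length)) (by omega)))
      omega
  have start : PolyTime ec (fun c => prodEnc unaryEncodeNat (prodEnc ec ea) (n c, c, s c))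
    fun c => c := (hn.pair (PolyTime.id.pair hs)).recode fun _ => rfl
  simpa only [iterate_prodMk] using (run.comp start).right

/-! ### Numbers in unary -/

section Unary

variable [Finite C]

theorem PolyTime.code_length : PolyTime ec unaryEncodeNat fun c => (ec c).length :=
  .flatMap (fun _ => [true]) fun c => by
    rw [unaryEncodeNat_eq_replicate, ← List.map_eq_flatMap, List.map_const']

theorem PolyTime.unary_add {m n : γ → ℕ} (hm : PolyTime ec unaryEncodeNat m)
    (hn : PolyTime ec unaryEncodeNat n) : PolyTime ec unaryEncodeNat fun c => m c + n c :=
  PolyTime.comp (g := fun p : ℕ × ℕ => p.1 + p.2)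
    (.flatMap (fun s => [s.elim (fun b => b) fun b => b]) fun p => by
      simp [← List.map_eq_flatMap, prodEnc, unaryEncodeNat_eq_replicate]) (hm.pair hn)

theorem PolyTime.unary_pred {m : γ → ℕ} (hm : PolyTime ec unaryEncodeNat m) :
    PolyTime ec unaryEncodeNat fun c => m c - 1 := by
  let T : Transducer Bool Bool Bool :=
    ⟨false, fun _ _ => true, fun q a => if q then [a] else [], fun _ => []⟩
  refine PolyTime.comp (g := fun n => n - 1) (.transduce T fun n => ?_) hm
  cases n with
  | zero => rfl
  | succ n =>
    change _ = T.scan true (unaryEncodeNat n) ++ []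
    simp [T.scan_of_next_eq (q := true) fun _ _ => rfl, T]

theorem PolyTime.unary_sub {m n : γ → ℕ} (hm : PolyTime ec unaryEncodeNat m)
    (hn : PolyTime ec unaryEncodeNat n) : PolyTime ec unaryEncodeNat fun c => m c - n c := by
  have iterate (i a : ℕ) : Nat.pred^[i] a = a - i := Nat.pred_iterate a i
  have := PolyTime.iterate (f := fun _ : γ => Nat.pred) PolyTime.snd.unary_pred hn hm hm.bdd_unary
    fun c i _ => by rw [iterate, length_unaryEncodeNat]; omega
  simpa only [iterate] using this

theorem PolyTime.unary_mul {m n : γ → ℕ} (hm : PolyTime ec unaryEncodeNat m)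
    (hn : PolyTime ec unaryEncodeNat n) : PolyTime ec unaryEncodeNat fun c => m c * n c := by
  have iterate (c : γ) (i : ℕ) : (fun a => a + m c)^[i] 0 = m c * i := by
    simp [mul_comm]
  have := PolyTime.iterate (f := fun (c : γ) a => a + m c)
    (PolyTime.snd.unary_add (hm.comp PolyTime.fst)) hn (.const 0)
    (hm.bdd_unary.mul hn.bdd_unary)
    fun c i hi => by rw [iterate, length_unaryEncodeNat]; exact Nat.mul_le_mul_left _ hi
  simpa only [iterate] using this

theorem PolyTime.unary_eval (p : Polynomial ℕ) {n : γ → ℕ} (hn : PolyTime ec unaryEncodeNat n) :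
    PolyTime ec unaryEncodeNat fun c => p.eval (n c) := by
  induction p using Polynomial.induction_on with
  | C a => simpa using PolyTime.const a
  | add p q hp hq => simpa using hp.unary_add hq
  | monomial k a ih => simpa [pow_succ, mul_assoc] using ih.unary_mul hn

theorem PolyTime.unary_isZero {m : γ → ℕ} (hm : PolyTime ec unaryEncodeNat m) :
    PolyTime ec encodeBool fun c => m c == 0 := by
  let T : Transducer Bool Bool Bool := ⟨true, fun _ _ => false, fun _ _ => [], fun q => [q]⟩
  refine PolyTime.comp (g := fun n : ℕ => n == 0) (.transduce T fun n => ?_) hm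
  cases n with
  | zero => rfl
  | succ n =>
    change _ = T.scan false (unaryEncodeNat n) ++ T.final ((unaryEncodeNat n).foldl T.next false)
    rw [T.scan_of_next_eq fun _ _ => rfl, T.foldl_next_of_next_eq fun _ _ => rfl]
    simp [T, encodeBool]

end Unary

/-! ### Lists -/

/-- The code of a list: the code of each element is followed by an end marker. -/
def listEnc (ea : α → List A) (l : List α) : List (Option A) :=
  l.flatMap fun a => (ea a).map some ++ [none]

@[simp]
theorem listEnc_nil : listEnc ea [] = [] := rfl

@[simp]
theorem listEnc_cons (a : α) (l : List α) :
    listEnc ea (a :: l) = (ea a).map some ++ none :: listEnc ea l := by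
  simp [listEnc]

theorem listEnc_append (l l' : List α) : listEnc ea (l ++ l') = listEnc ea l ++ listEnc ea l' :=
  List.flatMap_append

theorem length_le_length_listEnc (l : List α) : l.length ≤ (listEnc ea l).length := by
  induction l with
  | nil => rfl
  | cons a l ih =>
    rw [listEnc_cons, List.length_append, List.length_cons, List.length_cons]
    omega

theorem length_listEnc_encodeBool (l : List Bool) :
    (listEnc encodeBool l).length = 2 * l.length := by
  simp [listEnc, encodeBool, mul_comm]

theorem length_listEnc_reverse (l : List α) :
    (listEnc ea l.reverse).length = (listEnc ea l).length :=
  (l.reverse_perm.flatMap_right _).length_eq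

theorem length_listEnc_drop_le (n : ℕ) (l : List α) :
    (listEnc ea (l.drop n)).length ≤ (listEnc ea l).length := by
  conv_rhs => rw [← List.take_append_drop n l, listEnc_append, List.length_append]
  exact Nat.le_add_left _ _

theorem PolyTime.toList [Finite C] {l : γ → List Bool}
    (h : PolyTime ec (fun l : List Bool => l) l) : PolyTime ec (listEnc encodeBool) l :=
  PolyTime.comp (g := fun l => l) (.flatMap (fun b => [some b, none]) fun _ => rfl) h

theorem PolyTime.ofList [Finite C] {l : γ → List Bool} (h : PolyTime ec (listEnc encodeBool) l) :
    PolyTime ec (fun l : List Bool => l) l := by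
  refine PolyTime.comp (g := fun l => l) (.flatMap Option.toList fun l => ?_) h
  induction l with
  | nil => rfl
  | cons a l ih => simpa [encodeBool] using ih

variable [Finite A] [Finite C]

theorem PolyTime.cons {a : γ → α} {l : γ → List α} (ha : PolyTime ec ea a)
    (hl : PolyTime ec (listEnc ea) l) : PolyTime ec (listEnc ea) fun c => a c :: l c := by
  let T : Transducer (A ⊕ Option A) (Option A) Bool :=
    ⟨false, fun _ s => s.isRight,
      fun q => Sum.elim (fun a => [some a]) fun o => if q then [o] else [none, o],
      fun q => if q then [] else [none]⟩
  refine PolyTime.comp (g := fun p : α × List α => p.1 :: p.2) (.transduce T fun p => ?_)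
    (ha.pair hl)
  have head : ∀ s ∈ (ea p.1).map Sum.inl, T.next false s = false := by simp [T]
  have tail (l : List (Option A)) : ∀ s ∈ l.map Sum.inr, T.next true s = true := by simp [T]
  rw [Transducer.run, prodEnc, T.scan_append, T.scan_of_next_eq head, List.foldl_append,
    T.foldl_next_of_next_eq head]
  rw [listEnc_cons]
  cases listEnc ea p.2 with
  | nil => simp [T, Transducer.scan, List.flatMap_map, ← List.map_eq_flatMap]
  | cons o l =>
    change _ = _ ++ (none :: o :: T.scan true (l.map .inr)) ++
      T.final ((l.map .inr).foldl T.next true)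
    rw [T.scan_of_next_eq (tail l), T.foldl_next_of_next_eq (tail l)]
    simp [T, List.flatMap_map, ← List.map_eq_flatMap]

theorem PolyTime.append {l l' : γ → List α} (hl : PolyTime ec (listEnc ea) l)
    (hl' : PolyTime ec (listEnc ea) l') : PolyTime ec (listEnc ea) fun c => l c ++ l' c :=
  PolyTime.comp (g := fun p : List α × List α => p.1 ++ p.2)
    (.flatMap (fun s => [s.elim (fun a => a) fun a => a]) fun p => by
      simp [← List.map_eq_flatMap, listEnc_append, prodEnc]) (hl.pair hl')

theorem PolyTime.tail {l : γ → List α} (hl : PolyTime ec (listEnc ea) l) :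
    PolyTime ec (listEnc ea) fun c => (l c).tail := by
  let T : Transducer (Option A) (Option A) Bool :=
    ⟨false, fun q s => q || s.isNone, fun q s => if q then [s] else [], fun _ => []⟩
  refine PolyTime.comp (g := List.tail) (.transduce T fun l => ?_) hl
  rcases l with _ | ⟨a, l⟩
  · rfl
  have head : ∀ s ∈ (ea a).map some, T.next false s = false := by simp [T]
  rw [listEnc_cons, Transducer.run, T.scan_append, T.scan_of_next_eq head,
    T.foldl_next_of_next_eq head]
  change _ = _ ++ T.scan true (listEnc ea l) ++ []
  rw [T.scan_of_next_eq fun _ _ => rfl]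
  simp [T]

/-- The states `none`, `some false` and `some true` mean that nothing, a part or all of the first
element has been read. -/
def Transducer.headD (w : List A) : Transducer (Option A) A (Option Bool) where
  start := none
  next q s := some (q == some true || s.isNone)
  out q s := if q = some true then [] else s.toList
  final q := if q = none then w else []

theorem PolyTime.headD (d : α) {l : γ → List α} (hl : PolyTime ec (listEnc ea) l) :
    PolyTime ec ea fun c => (l c).headD d := by
  let T := Transducer.headD (ea d)
  refine PolyTime.comp (g := fun l => List.headD l d) (.transduce T fun l => ?_) hl
  rcases l with _ | ⟨a, l⟩
  · rfl
  have finish (l : List (Option A)) :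
      T.scan (some true) l ++ T.final (l.foldl T.next (some true)) = [] := by
    rw [T.scan_of_next_eq fun _ _ => rfl, T.foldl_next_of_next_eq fun _ _ => rfl]
    simp [T, Transducer.headD]
  rw [listEnc_cons, Transducer.run]
  rcases h : ea a with _ | ⟨x, m⟩
  · exact h.trans (finish _).symm
  have head : ∀ s ∈ m.map some, T.next (some false) s = some false := by simp [T, Transducer.headD]
  change _ = x :: T.scan (some false) (m.map some ++ none :: listEnc ea l) ++
    T.final ((m.map some ++ none :: listEnc ea l).foldl T.next (some false))
  rw [T.scan_append, T.scan_of_next_eq head, List.foldl_append, T.foldl_next_of_next_eq head,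
    List.cons_append, List.append_assoc]
  exact (by simp [h, T, Transducer.headD, List.flatMap_map] :
    ea a = x :: ((m.map some).flatMap (T.out (some false)) ++ [])).trans
      (congrArg (fun w => x :: (_ ++ w)) (finish (listEnc ea l)).symm)

theorem PolyTime.isEmpty {l : γ → List α} (hl : PolyTime ec (listEnc ea) l) :
    PolyTime ec encodeBool fun c => (l c).isEmpty := by
  have isEmpty_eq (l : List α) : l.isEmpty = ((listEnc ea l).length == 0) := by
    cases l <;> simp
  simp only [isEmpty_eq]
  exact PolyTime.code_length.unary_isZero.comp hl

theorem PolyTime.length {l : γ → List α} (hl : PolyTime ec (listEnc ea) l) :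
    PolyTime ec unaryEncodeNat fun c => (l c).length := by
  refine PolyTime.comp (g := List.length)
    (.flatMap (fun o => o.elim [true] fun _ => []) fun l => ?_) hl
  induction l with
  | nil => rfl
  | cons a l ih =>
    simp [unaryEncodeNat, ih, List.flatMap_append, List.flatMap_map]

theorem PolyTime.replicate (a : α) {n : γ → ℕ} (hn : PolyTime ec unaryEncodeNat n) :
    PolyTime ec (listEnc ea) fun c => List.replicate (n c) a :=
  PolyTime.comp (g := fun n => List.replicate n a)
    (.flatMap (fun _ => (ea a).map some ++ [none]) fun n => by
      simp [listEnc, unaryEncodeNat_eq_replicate, List.flatMap_def]) hn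

theorem iterate_uncons_foldl (f : β → α → β) (d : α) (l : List α) (s : β) (i : ℕ) :
    (fun p : List α × β => if p.1.isEmpty then p else (p.1.tail, f p.2 (p.1.headD d)))^[i] (l, s) =
      (l.drop i, (l.take i).foldl f s) := by
  induction i generalizing l s with
  | zero => rfl
  | succ i ih =>
    rw [iterate_succ_apply]
    cases l with
    | nil => simpa using ih [] s
    | cons a l => simpa using ih l (f s a)

theorem PolyTime.foldl [Finite B] {f : γ → β → α → β} {l : γ → List α} {s : γ → β} {b : γ → ℕ}
    (hf : PolyTime (prodEnc ec (prodEnc eb ea)) eb fun p => f p.1 p.2.1 p.2.2)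
    (hl : PolyTime ec (listEnc ea) l) (hs : PolyTime ec eb s) (hb : PolyBdd ec b)
    (h : ∀ c l₁ l₂, l c = l₁ ++ l₂ → (eb (l₁.foldl (f c) (s c))).length ≤ b c) :
    PolyTime ec eb fun c => (l c).foldl (f c) (s c) := by
  rcases isEmpty_or_nonempty α with _ | ⟨⟨d⟩⟩
  · have nil (c : γ) : l c = [] := Subsingleton.elim _ _
    simpa [nil] using hs
  have state := PolyTime.snd (ea := ec) (eb := prodEnc (listEnc ea) eb)
  have step := PolyTime.ite state.left.isEmpty state (state.left.tail.pair
    (hf.comp (PolyTime.fst.pair (state.right.pair (state.left.headD d)))))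
  have run := PolyTime.iterate (f := fun c p => if p.1.isEmpty then p else
    (p.1.tail, f c p.2 (p.1.headD d))) step hl.length (hl.pair hs) (hl.bdd.add hb) fun c i _ => by
      rw [iterate_uncons_foldl, length_prodEnc]
      exact Nat.add_le_add (length_listEnc_drop_le i (l c))
        (h c _ _ (List.take_append_drop i (l c)).symm)
  simp only [iterate_uncons_foldl, List.take_length] at run
  exact run.right

theorem PolyTime.reverse {l : γ → List α} (hl : PolyTime ec (listEnc ea) l) :
    PolyTime ec (listEnc ea) fun c => (l c).reverse := by
  have reverse (l : List α) : l.foldl (fun b a => a :: b) [] = l.reverse := by simp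
  have := PolyTime.foldl (f := fun (_ : γ) (b : List α) a => a :: b)
    (PolyTime.snd.right.cons PolyTime.snd.left) hl (.const []) hl.bdd fun c l₁ l₂ h => by
      rw [reverse, length_listEnc_reverse, h, listEnc_append, List.length_append]
      exact Nat.le_add_right _ _
  simpa only [reverse] using this

theorem PolyTime.drop {l : γ → List α} {n : γ → ℕ} (hn : PolyTime ec unaryEncodeNat n)
    (hl : PolyTime ec (listEnc ea) l) : PolyTime ec (listEnc ea) fun c => (l c).drop (n c) := by
  have iterate (i : ℕ) (l : List α) : List.tail^[i] l = l.drop i := by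
    induction i with
    | zero => rfl
    | succ i ih => rw [iterate_succ_apply', ih, List.tail_drop]
  have := PolyTime.iterate (f := fun (_ : γ) l => List.tail l) PolyTime.snd.tail hn hl hl.bdd
    fun c i _ => (iterate i (l c)).symm ▸ length_listEnc_drop_le i (l c)
  simpa only [iterate] using this

theorem PolyTime.take {l : γ → List α} {n : γ → ℕ} (hn : PolyTime ec unaryEncodeNat n)
    (hl : PolyTime ec (listEnc ea) l) : PolyTime ec (listEnc ea) fun c => (l c).take (n c) := by
  have take_eq (n : ℕ) (l : List α) : l.take n = (l.reverse.drop (l.length - n)).reverse := by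
    simpa using List.take_reverse (xs := l.reverse) (i := n)
  simp only [take_eq]
  exact (PolyTime.drop (hl.length.unary_sub hn) hl.reverse).reverse

theorem PolyTime.getD (d : α) {l : γ → List α} {n : γ → ℕ} (hn : PolyTime ec unaryEncodeNat n)
    (hl : PolyTime ec (listEnc ea) l) : PolyTime ec ea fun c => (l c).getD (n c) d := by
  simp only [List.getD_eq_getElem?_getD, ← List.head?_drop, ← List.headD_eq_head?_getD]
  exact (PolyTime.drop hn hl).headD d

theorem PolyTime.set {l : γ → List α} {n : γ → ℕ} {a : γ → α} (hn : PolyTime ec unaryEncodeNat n)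
    (ha : PolyTime ec ea a) (hl : PolyTime ec (listEnc ea) l) :
    PolyTime ec (listEnc ea) fun c => (l c).set (n c) (a c) := by
  have set_eq (n : ℕ) (l : List α) (a : α) : l.set n a =
      if (l.drop n).isEmpty then l else l.take n ++ a :: l.drop (n + 1) := by
    rw [List.set_eq_take_append_cons_drop]
    by_cases h : n < l.length
    · simp [h]
    · simp [h, not_lt.1 h]
  simp only [set_eq]
  exact .ite (PolyTime.drop hn hl).isEmpty hl
    ((PolyTime.take hn hl).append (ha.cons (PolyTime.drop (hn.unary_add (.const 1)) hl)))

end Stoq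

namespace Stoq

open Computability Turing Function

/-! ### Numbers in binary -/

/-- The value of a string of binary digits, the least significant one first. -/
def bitsVal (l : List Bool) : ℕ :=
  Nat.ofDigits 2 (l.map Bool.toNat)

@[simp]
theorem bitsVal_nil : bitsVal [] = 0 := rfl

@[simp]
theorem bitsVal_cons (b : Bool) (l : List Bool) : bitsVal (b :: l) = b.toNat + 2 * bitsVal l := by
  simp [bitsVal, Nat.ofDigits_cons]

theorem bitsVal_append (l l' : List Bool) :
    bitsVal (l ++ l') = bitsVal l + 2 ^ l.length * bitsVal l' := by
  simp [bitsVal, Nat.ofDigits_append]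

theorem bitsVal_lt (l : List Bool) : bitsVal l < 2 ^ l.length := by
  rw [← List.length_map Bool.toNat]
  exact Nat.ofDigits_lt_base_pow_length one_lt_two (List.forall_mem_map.2 fun b _ => b.toNat_lt)

theorem bits_bit (b : Bool) (n : ℕ) :
    (Nat.bit b n).bits = if n.bits.isEmpty && !b then [] else b :: n.bits := by
  rcases Nat.eq_zero_or_pos n with rfl | hn
  · cases b <;> simp
  · have : n.bits ≠ [] := fun h => hn.ne' (Nat.size_eq_zero.1 (by simp [← Nat.size_eq_bits_len, h]))
    rw [Nat.bits_append_bit _ _ fun h => (hn.ne' h).elim]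
    simp [this]

theorem encodeNat_eq_bits (n : ℕ) : encodeNat n = n.bits := by
  induction n using Nat.binaryRec with
  | zero => rfl
  | bit b n ih =>
    rw [bits_bit, ← ih, encodeNat, encodeNat, ← Num.ofNat'_eq, Num.ofNat'_bit, Num.ofNat'_eq]
    cases (n : Num) with
    | zero => cases b <;> rfl
    | pos p => cases b <;> simp [encodeNum, Num.bit0, Num.bit1, encodePosNum, encodePosNum_nonempty]

theorem bitsVal_encodeNat (n : ℕ) : bitsVal (encodeNat n) = n := by
  rw [encodeNat_eq_bits]
  induction n using Nat.binaryRec' with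
  | zero => rfl
  | bit b n h ih => rw [Nat.bits_append_bit _ _ h, bitsVal_cons, ih, Nat.bit_val, Nat.add_comm]

theorem length_encodeNat (n : ℕ) : (encodeNat n).length = n.size := by
  rw [encodeNat_eq_bits, Nat.size_eq_bits_len]

theorem encodeNat_bitsVal (l : List Bool) : encodeNat (bitsVal l) =
    l.reverse.foldl (fun s b => if s.isEmpty && !b then [] else b :: s) [] := by
  induction l with
  | nil => rfl
  | cons b l ih =>
    rw [bitsVal_cons, Nat.add_comm, ← Nat.bit_val, encodeNat_eq_bits, bits_bit,
      ← encodeNat_eq_bits, ih, List.reverse_cons, List.foldl_append]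
    rfl

variable {γ C : Type} [Finite C] {ec : γ → List C}

theorem PolyTime.bits {x : γ → ℕ} (h : PolyTime ec encodeNat x) :
    PolyTime ec (listEnc encodeBool) fun c => encodeNat (x c) :=
  (h.recode (ea' := fun l : List Bool => l) fun _ => rfl).toList

theorem PolyTime.bitsVal {l : γ → List Bool} (h : PolyTime ec (listEnc encodeBool) l) :
    PolyTime ec encodeNat fun c => bitsVal (l c) := by
  have state := PolyTime.snd (ea := ec) (eb := prodEnc (listEnc encodeBool) encodeBool)
  have step := PolyTime.ite (.bool₂ (fun a b => a && !b) state.left.isEmpty state.right)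
    (.const []) (state.right.cons state.left)
  have run := PolyTime.foldl (f := fun (_ : γ) (s : List Bool) b =>
    if s.isEmpty && !b then [] else b :: s) step h.reverse (.const []) h.bdd
    fun c l₁ l₂ hl => by
      have length_le : l₁.length ≤ (l c).length := by
        simpa using (List.IsPrefix.length_le ⟨l₂, hl.symm⟩ : l₁.length ≤ (l c).reverse.length)
      have size_le := Nat.size_le.2 (bitsVal_lt l₁.reverse)
      rw [← length_encodeNat, encodeNat_bitsVal, List.reverse_reverse, List.length_reverse]
        at size_le
      rw [length_listEnc_encodeBool, length_listEnc_encodeBool]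
      exact Nat.mul_le_mul_left 2 (size_le.trans length_le)
  exact run.ofList.recode fun c => (encodeNat_bitsVal (l c)).symm

theorem length_encodeBool (b : Bool) : (encodeBool b).length = 1 := rfl

/-- One step of the addition of binary numbers: the digits of the two summands that remain, the
carry and the digits of the sum in reversed order. -/
def addStep (s : List Bool × List Bool × Bool × List Bool) :
    List Bool × List Bool × Bool × List Bool :=
  (s.1.tail, s.2.1.tail, Bool.atLeastTwo (s.1.headD false) (s.2.1.headD false) s.2.2.1,
    xor (xor (s.1.headD false) (s.2.1.headD false)) s.2.2.1 :: s.2.2.2)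

theorem bitsVal_eq_headD_add_tail (l : List Bool) :
    bitsVal l = (l.headD false).toNat + 2 * bitsVal l.tail := by
  cases l <;> simp

theorem bitsVal_addStep (s : List Bool × List Bool × Bool × List Bool) :
    bitsVal (addStep s).2.2.2.reverse + 2 ^ (addStep s).2.2.2.length *
      (bitsVal (addStep s).1 + bitsVal (addStep s).2.1 + (addStep s).2.2.1.toNat) =
    bitsVal s.2.2.2.reverse + 2 ^ s.2.2.2.length *
      (bitsVal s.1 + bitsVal s.2.1 + s.2.2.1.toNat) := by
  obtain ⟨x, y, c, o⟩ := s
  have full_adder (a b : Bool) : (xor (xor a b) c).toNat + 2 * (Bool.atLeastTwo a b c).toNat =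
      a.toNat + b.toNat + c.toNat := by
    cases a <;> cases b <;> cases c <;> rfl
  simp only [addStep, List.reverse_cons, bitsVal_append, List.length_reverse, List.length_cons,
    bitsVal_cons, bitsVal_nil, bitsVal_eq_headD_add_tail x, bitsVal_eq_headD_add_tail y]
  linear_combination 2 ^ o.length * full_adder (x.headD false) (y.headD false)

theorem addStep_iterate (x y : List Bool) (i : ℕ) :
    (addStep^[i] (x, y, false, [])).1 = x.drop i ∧
    (addStep^[i] (x, y, false, [])).2.1 = y.drop i ∧
    (addStep^[i] (x, y, false, [])).2.2.2.length = i ∧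
    bitsVal (addStep^[i] (x, y, false, [])).2.2.2.reverse + 2 ^ i *
      (bitsVal (x.drop i) + bitsVal (y.drop i) + (addStep^[i] (x, y, false, [])).2.2.1.toNat) =
    bitsVal x + bitsVal y := by
  induction i with
  | zero => simp
  | succ i ih =>
    obtain ⟨hx, hy, ho, val⟩ := ih
    rw [iterate_succ_apply']
    generalize addStep^[i] (x, y, false, []) = s at *
    have hx' : (addStep s).1 = x.drop (i + 1) := by simp only [addStep, hx, List.tail_drop]
    have hy' : (addStep s).2.1 = y.drop (i + 1) := by simp only [addStep, hy, List.tail_drop]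
    have ho' : (addStep s).2.2.2.length = i + 1 := by simp [addStep, ho]
    have val' := bitsVal_addStep s
    rw [hx', hy', ho', hx, hy, ho, val] at val'
    exact ⟨hx', hy', ho', val'⟩

theorem bitsVal_addStep_iterate {x y : List Bool} {i : ℕ} (hx : x.length < i) (hy : y.length < i) :
    bitsVal (addStep^[i] (x, y, false, [])).2.2.2.reverse = bitsVal x + bitsVal y := by
  obtain ⟨-, -, -, val⟩ := addStep_iterate x y i
  rw [List.drop_of_length_le hx.le, List.drop_of_length_le hy.le] at val
  have bound (l : List Bool) (hl : l.length < i) : 2 * bitsVal l < 2 ^ i :=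
    calc 2 * bitsVal l < 2 ^ (l.length + 1) := by have := bitsVal_lt l; rw [pow_succ]; omega
      _ ≤ 2 ^ i := Nat.pow_le_pow_right two_pos hl
  have := bound x hx
  have := bound y hy
  cases hc : (addStep^[i] (x, y, false, [])).2.2.1 with
  | false => simpa [hc] using val
  | true =>
    simp only [hc, bitsVal_nil, Bool.toNat_true] at val
    omega

theorem PolyTime.addStep {s : γ → List Bool × List Bool × Bool × List Bool}
    (h : PolyTime ec (prodEnc (listEnc encodeBool) (prodEnc (listEnc encodeBool)
      (prodEnc encodeBool (listEnc encodeBool)))) s) :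
    PolyTime ec (prodEnc (listEnc encodeBool) (prodEnc (listEnc encodeBool)
      (prodEnc encodeBool (listEnc encodeBool)))) fun c => addStep (s c) := by
  have a := h.left.headD false
  have b := h.right.left.headD false
  have carry := h.right.right.left
  refine h.left.tail.pair (h.right.left.tail.pair (.pair ?_ (.cons ?_ h.right.right.right)))
  · exact .bool₂ (· || ·) (.bool₂ (· || ·) (.bool₂ (· && ·) a b) (.bool₂ (· && ·) a carry))
      (.bool₂ (· && ·) b carry)
  · exact .bool₂ xor (.bool₂ xor a b) carry

theorem PolyTime.add {x y : γ → ℕ} (hx : PolyTime ec encodeNat x) (hy : PolyTime ec encodeNat y) :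
    PolyTime ec encodeNat fun c => x c + y c := by
  have hn := (hx.bits.length.unary_add hy.bits.length).unary_add (.const 1)
  have run := PolyTime.iterate (f := fun (_ : γ) s => Stoq.addStep s) PolyTime.snd.addStep hn
    (hx.bits.pair (hy.bits.pair ((PolyTime.const false).pair (.const []))))
    (((hx.bits.bdd.add hy.bits.bdd).add (.const 1)).add (hn.bdd_unary.add hn.bdd_unary))
    fun c i hi => by
      obtain ⟨hx', hy', ho, -⟩ := addStep_iterate (encodeNat (x c)) (encodeNat (y c)) i
      simp only [length_prodEnc, hx', hy', ho, length_listEnc_encodeBool, List.length_drop,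
        length_encodeBool]
      omega
  have val (c : γ) : Stoq.bitsVal (Stoq.addStep^[(encodeNat (x c)).length +
      (encodeNat (y c)).length + 1] (encodeNat (x c), encodeNat (y c), false, [])).2.2.2.reverse =
      x c + y c := by
    rw [bitsVal_addStep_iterate (by omega) (by omega), bitsVal_encodeNat, bitsVal_encodeNat]
  simpa only [val] using run.right.right.right.reverse.bitsVal

theorem foldl_double_add (n : ℕ) (l : List Bool) :
    l.foldl (fun a b => a + a + if b then n else 0) 0 = bitsVal l.reverse * n := by
  induction l using List.reverseRecOn with
  | nil => simp
  | append_singleton l b ih =>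
    rw [List.foldl_append, List.foldl_cons, List.foldl_nil, ih, List.reverse_append,
      List.reverse_singleton, List.singleton_append, bitsVal_cons]
    cases b <;> simp <;> ring

theorem PolyTime.mul {x y : γ → ℕ} (hx : PolyTime ec encodeNat x) (hy : PolyTime ec encodeNat y) :
    PolyTime ec encodeNat fun c => x c * y c := by
  have state := PolyTime.snd (ea := ec) (eb := prodEnc encodeNat encodeBool)
  have step := (state.left.add state.left).add
    (.ite state.right (hy.comp PolyTime.fst) (.const 0))
  have run := PolyTime.foldl (f := fun c a b => a + a + if b then y c else 0) step hx.bits.reverse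
    (.const 0) (hx.bdd.add hy.bdd) fun c l₁ l₂ hl => by
      have split : encodeNat (x c) = l₂.reverse ++ l₁.reverse := by
        rw [← List.reverse_append, ← hl, List.reverse_reverse]
      have le : Stoq.bitsVal l₁.reverse ≤ x c := by
        conv_rhs => rw [← bitsVal_encodeNat (x c), split, bitsVal_append]
        exact (Nat.le_mul_of_pos_left _ (by positivity)).trans (Nat.le_add_left _ _)
      rw [foldl_double_add, length_encodeNat, length_encodeNat, length_encodeNat, Nat.size_le,
        pow_add]
      exact Nat.mul_lt_mul'' (le.trans_lt (Nat.lt_size_self _)) (Nat.lt_size_self _)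
  simpa only [foldl_double_add, List.reverse_reverse, bitsVal_encodeNat] using run

theorem size_pow_le (n k : ℕ) : (n ^ k).size ≤ k * n.size + 1 := by
  rw [Nat.size_le]
  calc n ^ k ≤ (2 ^ n.size) ^ k := Nat.pow_le_pow_left (Nat.lt_size_self n).le k
    _ = 2 ^ (k * n.size) := by rw [← pow_mul, mul_comm]
    _ < 2 ^ (k * n.size + 1) := Nat.pow_lt_pow_right one_lt_two (Nat.lt_succ_self _)

theorem PolyTime.pow {x k : γ → ℕ} (hx : PolyTime ec encodeNat x)
    (hk : PolyTime ec unaryEncodeNat k) : PolyTime ec encodeNat fun c => x c ^ k c := by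
  have iterate (i n : ℕ) : (fun a => a * n)^[i] 1 = n ^ i := by simp
  have run := PolyTime.iterate (f := fun c a => a * x c) (PolyTime.snd.mul (hx.comp PolyTime.fst))
    hk (.const 1) ((hk.bdd_unary.mul hx.bdd).add (.const 1)) fun c i hi => by
      rw [iterate, length_encodeNat, length_encodeNat]
      exact (size_pow_le (x c) i).trans (Nat.succ_le_succ (Nat.mul_le_mul_right _ hi))
  simpa only [iterate] using run

/-! ### Simulation of circuits on strings -/

/-- The code of a list of binary digits. -/
abbrev bitsEnc : List Bool → List (Option Bool) := listEnc encodeBool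

/-- The code of a list of indices. -/
abbrev indexEnc : List ℕ → List (Option Bool) := listEnc unaryEncodeNat

theorem length_indexEnc_cons (a : ℕ) (l : List ℕ) :
    (indexEnc (a :: l)).length = (indexEnc l).length + (a + 1) := by
  simp only [indexEnc, listEnc_cons, List.length_append, List.length_cons, List.length_map,
    length_unaryEncodeNat]
  omega

theorem length_indexEnc_append (l l' : List ℕ) :
    (indexEnc (l ++ l')).length = (indexEnc l).length + (indexEnc l').length := by
  rw [indexEnc, listEnc_append, List.length_append]

theorem length_foldl_of_length_eq {α β : Type*} {f : List β → α → List β}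
    (h : ∀ r a, (f r a).length = r.length) (l : List α) (r : List β) :
    (l.foldl f r).length = r.length := by
  induction l generalizing r with
  | nil => rfl
  | cons a l ih => rw [List.foldl_cons, ih, h]

/-- Controlled negation on a register of bits. A gate is given by the index of its target followed
by the indices of its controls. -/
def applyCtl (r : List Bool) (g : List ℕ) : List Bool :=
  r.set (g.headD 0) (xor (r.getD (g.headD 0) false)
    (g.tail.foldl (fun b c => b && r.getD c false) true))

theorem length_applyCtl (r : List Bool) (g : List ℕ) : (applyCtl r g).length = r.length := by
  simp [applyCtl]

theorem PolyTime.applyCtl {r : γ → List Bool} {g : γ → List ℕ} (hr : PolyTime ec bitsEnc r)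
    (hg : PolyTime ec indexEnc g) : PolyTime ec bitsEnc fun c => applyCtl (r c) (g c) := by
  have target := hg.headD 0
  have controls := PolyTime.foldl (f := fun c b i => b && (r c).getD i false)
    (PolyTime.bool₂ (· && ·) PolyTime.snd.left (PolyTime.getD false PolyTime.snd.right
      (hr.comp PolyTime.fst))) hg.tail (PolyTime.const (eb := encodeBool) true) (PolyBdd.const 1)
      fun _ _ _ _ => le_rfl
  exact PolyTime.set target (PolyTime.bool₂ xor (PolyTime.getD false target hr) controls) hr

/-- The action of a circuit, given as the list of its gates in the order of application, on a
register of bits. -/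
def runGates (gs : List (List ℕ)) (r : List Bool) : List Bool := gs.foldl applyCtl r

theorem length_runGates (gs : List (List ℕ)) (r : List Bool) :
    (runGates gs r).length = r.length :=
  length_foldl_of_length_eq length_applyCtl gs r

theorem PolyTime.runGates {gs : γ → List (List ℕ)} {r : γ → List Bool}
    (hg : PolyTime ec (listEnc indexEnc) gs) (hr : PolyTime ec bitsEnc r) :
    PolyTime ec bitsEnc fun c => runGates (gs c) (r c) := by
  refine PolyTime.foldl (f := fun _ => Stoq.applyCtl)
    (PolyTime.snd.left.applyCtl PolyTime.snd.right) hg hr hr.bdd fun c l₁ l₂ _ => ?_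
  rw [length_listEnc_encodeBool, length_listEnc_encodeBool,
    length_foldl_of_length_eq length_applyCtl]

/-! ### Decoding a list of gates -/

/-- One step of the decoding of a list of gates. The state holds the number of indices that are to
come, the indices of the current gate, and the gates found; both lists are in reversed order. -/
def parseStep (s : ℕ × List ℕ × List (List ℕ)) (a : ℕ) : ℕ × List ℕ × List (List ℕ) :=
  if s.1 == 0 then (a + 1, [], s.2.2)
  else (s.1 - 1, a :: s.2.1, if s.1 - 1 == 0 then (a :: s.2.1) :: s.2.2 else s.2.2)

/-- The gates described by a concatenation of gate codes, the last gate first. A type tag `a`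
announces `a + 1` indices, of which the target is the last and so becomes the first. -/
def parse (l : List ℕ) : List (List ℕ) := (l.foldl parseStep (0, [], [])).2.2

/-- The code of the states of `parseStep`. -/
abbrev parseEnc : ℕ × List ℕ × List (List ℕ) → List (Bool ⊕ (Option Bool ⊕ Option (Option Bool))) :=
  prodEnc unaryEncodeNat (prodEnc indexEnc (listEnc indexEnc))

theorem length_parseStep_le (s : ℕ × List ℕ × List (List ℕ)) (a : ℕ) :
    (parseStep s a).1 ≤ max s.1 (a + 1) ∧
      (indexEnc (parseStep s a).2.1).length ≤ (indexEnc s.2.1).length + (a + 1) ∧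
      (listEnc indexEnc (parseStep s a).2.2).length ≤
        (listEnc indexEnc s.2.2).length + (indexEnc s.2.1).length + (a + 2) := by
  have length_push : (listEnc indexEnc ((a :: s.2.1) :: s.2.2)).length =
      (listEnc indexEnc s.2.2).length + (indexEnc s.2.1).length + (a + 2) := by
    rw [listEnc_cons, List.length_append, List.length_map, List.length_cons, length_indexEnc_cons]
    omega
  unfold parseStep
  split
  · exact ⟨le_max_right _ _, Nat.zero_le _, by dsimp only; omega⟩
  · refine ⟨(Nat.sub_le _ _).trans (le_max_left _ _), (length_indexEnc_cons _ _).le, ?_⟩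
    dsimp only
    split <;> omega

theorem length_foldl_parseStep_le (l : List ℕ) :
    (l.foldl parseStep (0, [], [])).1 ≤ (indexEnc l).length ∧
      (indexEnc (l.foldl parseStep (0, [], [])).2.1).length ≤ (indexEnc l).length ∧
      (listEnc indexEnc (l.foldl parseStep (0, [], [])).2.2).length ≤
        l.length * ((indexEnc l).length + 1) := by
  induction l using List.reverseRecOn with
  | nil => simp
  | append_singleton l a ih =>
    rw [List.foldl_append, List.foldl_cons, List.foldl_nil]
    obtain ⟨hcount, hcurrent, hgates⟩ := ih
    obtain ⟨hcount', hcurrent', hgates'⟩ :=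
      length_parseStep_le (l.foldl parseStep (0, [], [])) a
    have hlength : (indexEnc (l ++ [a])).length = (indexEnc l).length + (a + 1) := by
      rw [length_indexEnc_append, length_indexEnc_cons, indexEnc, listEnc_nil]
      exact congrArg _ (Nat.zero_add _)
    rw [hlength, List.length_append, List.length_singleton]
    refine ⟨by omega, by omega, ?_⟩
    calc _ ≤ l.length * ((indexEnc l).length + 1) + ((indexEnc l).length + (a + 1) + 1) := by omega
      _ ≤ l.length * ((indexEnc l).length + (a + 1) + 1) +
          ((indexEnc l).length + (a + 1) + 1) := by gcongr; omega
      _ = _ := by ring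

theorem length_parseEnc_foldl_le (l : List ℕ) :
    (parseEnc (l.foldl parseStep (0, [], []))).length ≤
      (l.length + 2) * ((indexEnc l).length + 1) := by
  obtain ⟨hcount, hcurrent, hgates⟩ := length_foldl_parseStep_le l
  rw [length_prodEnc, length_prodEnc, length_unaryEncodeNat]
  calc _ ≤ l.length * ((indexEnc l).length + 1) + 2 * ((indexEnc l).length + 1) := by omega
    _ = _ := by ring

theorem PolyTime.parseStep : PolyTime (prodEnc ec (prodEnc parseEnc unaryEncodeNat)) parseEnc
    fun p => parseStep p.2.1 p.2.2 := by
  have args := PolyTime.snd (ea := ec) (eb := prodEnc parseEnc unaryEncodeNat)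
  have current := args.right.cons args.left.right.left
  have gates := args.left.right.right
  have count := args.left.left.unary_pred
  exact PolyTime.ite args.left.left.unary_isZero
    ((args.right.unary_add (PolyTime.const 1)).pair ((PolyTime.const []).pair gates))
    (count.pair (current.pair (PolyTime.ite count.unary_isZero (current.cons gates) gates)))

theorem PolyTime.parse {l : γ → List ℕ} (hl : PolyTime ec indexEnc l) :
    PolyTime ec (listEnc indexEnc) fun c => parse (l c) := by
  refine (PolyTime.foldl (f := fun _ => Stoq.parseStep) PolyTime.parseStep hl
    (PolyTime.const (0, [], []))
    ((hl.bdd.add (PolyBdd.const 2)).mul (hl.bdd.add (PolyBdd.const 1)))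
    fun c l₁ l₂ hl₁ => (length_parseEnc_foldl_le l₁).trans ?_).right.right
  have hlength : (indexEnc (l c)).length = (indexEnc l₁).length + (indexEnc l₂).length := by
    rw [hl₁, length_indexEnc_append]
  have hle : l₁.length ≤ (indexEnc l₁).length := length_le_length_listEnc l₁
  exact Nat.mul_le_mul (by omega) (by omega)

/-! ### Equality of strings -/

/-- One step of the comparison of two strings. The state tells whether the symbols read so far
agree, and holds the rest of the second string. -/
def beqStep (s : Bool × List Bool) (a : Bool) : Bool × List Bool :=
  (s.1 && (!s.2.isEmpty && (s.2.headD false == a)), s.2.tail)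

theorem foldl_beqStep_snd (l l' : List Bool) (b : Bool) :
    (l.foldl beqStep (b, l')).2 = l'.drop l.length := by
  induction l generalizing l' b with
  | nil => rfl
  | cons a l ih => rw [List.foldl_cons, beqStep, ih, List.drop_tail, List.length_cons]

theorem foldl_beqStep_fst (l l' : List Bool) (b : Bool) :
    ((l.foldl beqStep (b, l')).1 && (l'.drop l.length).isEmpty) = (b && l == l') := by
  induction l generalizing l' b with
  | nil => cases l' <;> simp
  | cons a l ih =>
    cases l' with
    | nil => simpa [beqStep] using ih [] false
    | cons a' l' =>
      have hstep : beqStep (b, a' :: l') a = (b && (a' == a), l') := by simp [beqStep]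
      rw [List.foldl_cons, hstep, List.length_cons, List.drop_succ_cons, ih, List.cons_beq_cons,
        Bool.beq_comm, Bool.and_assoc]

theorem PolyTime.beqStep : PolyTime (prodEnc ec (prodEnc (prodEnc encodeBool bitsEnc) encodeBool))
    (prodEnc encodeBool bitsEnc) fun p => beqStep p.2.1 p.2.2 := by
  have args := PolyTime.snd (ea := ec) (eb := prodEnc (prodEnc encodeBool bitsEnc) encodeBool)
  have agree := PolyTime.bool₂ (· && ·) args.left.right.isEmpty.not
    (PolyTime.bool₂ (· == ·) (args.left.right.headD false) args.right)
  exact (PolyTime.bool₂ (· && ·) args.left.left agree).pair args.left.right.tail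

theorem PolyTime.beq {l l' : γ → List Bool} (hl : PolyTime ec bitsEnc l)
    (hl' : PolyTime ec bitsEnc l') : PolyTime ec encodeBool fun c => l c == l' c := by
  have compare := PolyTime.foldl (f := fun (_ : γ) => Stoq.beqStep) PolyTime.beqStep hl
    ((PolyTime.const true).pair hl') ((PolyBdd.const 1).add hl'.bdd) fun c l₁ l₂ _ => by
      rw [length_prodEnc, length_encodeBool, foldl_beqStep_snd]
      exact Nat.add_le_add_left (length_listEnc_drop_le _ _) _
  have finish := PolyTime.bool₂ (· && ·) compare.left (PolyTime.drop hl.length hl').isEmpty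
  simpa only [foldl_beqStep_fst, Bool.true_and] using finish

/-! ### The counted predicate -/

/-- The register after one round: load the input `x`, the witness bits `w`, zeros and the bits of
the block `v` but the first one, apply the circuit, flip the first bit if the first bit of `v` is
set, and undo the circuit. The list `gs` holds the gates in reversed order. -/
def roundReg (gs : List (List ℕ)) (n0 : ℕ) (x w v : List Bool) : List Bool :=
  runGates gs ((runGates gs.reverse (x ++ (w ++ (List.replicate n0 false ++ v.tail)))).set 0
    (xor ((runGates gs.reverse (x ++ (w ++ (List.replicate n0 false ++ v.tail)))).getD 0 false)
      (v.headD false)))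

/-- The witness bits after one round. -/
def roundWit (gs : List (List ℕ)) (nw n0 : ℕ) (x w v : List Bool) : List Bool :=
  ((roundReg gs n0 x w v).drop x.length).take nw

/-- The round restores the input bits and the zeros. -/
def roundOk (gs : List (List ℕ)) (nw n0 : ℕ) (x w v : List Bool) : Bool :=
  (roundReg gs n0 x w v).take (x.length + (nw + n0)) ==
    x ++ (roundWit gs nw n0 x w v ++ List.replicate n0 false)

/-- One round. The state holds a flag, the witness bits and the blocks that are left, each of `D`
bits. -/
def round (gs : List (List ℕ)) (nw n0 D : ℕ) (x : List Bool) (s : Bool × List Bool × List Bool) :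
    Bool × List Bool × List Bool :=
  (s.1 && roundOk gs nw n0 x s.2.1 (s.2.2.take D), roundWit gs nw n0 x s.2.1 (s.2.2.take D),
    s.2.2.drop D)

/-- The predicate that is counted: `k` rounds succeed. The first block of `y` holds the initial
witness bits. -/
def accepts (gs : List (List ℕ)) (nw n0 D k : ℕ) (x y : List Bool) : Bool :=
  ((round gs nw n0 D x)^[k] (true, (y.take D).take nw, y.drop D)).1

theorem length_round_iterate_le (gs : List (List ℕ)) (n0 D : ℕ) (x : List Bool) {nw : ℕ}
    {s : Bool × List Bool × List Bool} (hs : s.2.1.length ≤ nw) (i : ℕ) :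
    ((round gs nw n0 D x)^[i] s).2.1.length ≤ nw ∧
      ((round gs nw n0 D x)^[i] s).2.2.length ≤ s.2.2.length := by
  induction i with
  | zero => exact ⟨hs, le_rfl⟩
  | succ i ih =>
    rw [iterate_succ_apply']
    refine ⟨List.length_take_le _ _, ?_⟩
    rw [round, List.length_drop]
    exact (Nat.sub_le _ _).trans ih.2

section PolyTime

variable {gs : γ → List (List ℕ)} {nw n0 D k : γ → ℕ} {x w v y : γ → List Bool}
  (hg : PolyTime ec (listEnc indexEnc) gs) (hn : PolyTime ec unaryEncodeNat nw)
  (h0 : PolyTime ec unaryEncodeNat n0) (hx : PolyTime ec bitsEnc x)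
include hg h0 hx

theorem PolyTime.roundReg (hw : PolyTime ec bitsEnc w) (hv : PolyTime ec bitsEnc v) :
    PolyTime ec bitsEnc fun c => roundReg (gs c) (n0 c) (x c) (w c) (v c) := by
  have computed := hg.reverse.runGates
    (hx.append (hw.append ((PolyTime.replicate false h0).append hv.tail)))
  exact hg.runGates (PolyTime.set (PolyTime.const 0) (PolyTime.bool₂ xor
    (PolyTime.getD false (PolyTime.const 0) computed) (hv.headD false)) computed)

include hn

theorem PolyTime.roundWit (hw : PolyTime ec bitsEnc w) (hv : PolyTime ec bitsEnc v) :
    PolyTime ec bitsEnc fun c => roundWit (gs c) (nw c) (n0 c) (x c) (w c) (v c) :=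
  PolyTime.take hn (PolyTime.drop hx.length (PolyTime.roundReg hg h0 hx hw hv))

theorem PolyTime.roundOk (hw : PolyTime ec bitsEnc w) (hv : PolyTime ec bitsEnc v) :
    PolyTime ec encodeBool fun c => roundOk (gs c) (nw c) (n0 c) (x c) (w c) (v c) :=
  (PolyTime.take (hx.length.unary_add (hn.unary_add h0)) (PolyTime.roundReg hg h0 hx hw hv)).beq
    (hx.append ((PolyTime.roundWit hg hn h0 hx hw hv).append (PolyTime.replicate false h0)))

theorem PolyTime.round (hD : PolyTime ec unaryEncodeNat D) :
    PolyTime (prodEnc ec (prodEnc encodeBool (prodEnc bitsEnc bitsEnc)))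
      (prodEnc encodeBool (prodEnc bitsEnc bitsEnc))
      fun p => round (gs p.1) (nw p.1) (n0 p.1) (D p.1) (x p.1) p.2 := by
  have param := PolyTime.fst (ea := ec) (eb := prodEnc encodeBool (prodEnc bitsEnc bitsEnc))
  have state := PolyTime.snd (ea := ec) (eb := prodEnc encodeBool (prodEnc bitsEnc bitsEnc))
  have block := PolyTime.take (hD.comp param) state.right.right
  have ok := PolyTime.roundOk (hg.comp param) (hn.comp param) (h0.comp param) (hx.comp param)
    state.right.left block
  have wit := PolyTime.roundWit (hg.comp param) (hn.comp param) (h0.comp param) (hx.comp param)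
    state.right.left block
  exact (PolyTime.bool₂ (· && ·) state.left ok).pair
    (wit.pair (PolyTime.drop (hD.comp param) state.right.right))

theorem PolyTime.accepts (hD : PolyTime ec unaryEncodeNat D) (hk : PolyTime ec unaryEncodeNat k)
    (hy : PolyTime ec bitsEnc y) :
    PolyTime ec encodeBool fun c => accepts (gs c) (nw c) (n0 c) (D c) (k c) (x c) (y c) := by
  refine (PolyTime.iterate (f := fun c => Stoq.round (gs c) (nw c) (n0 c) (D c) (x c))
    (PolyTime.round hg hn h0 hx hD) hk ((PolyTime.const true).pair
      ((PolyTime.take hn (PolyTime.take hD hy)).pair (PolyTime.drop hD hy)))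
    (((PolyBdd.const 1).add (hn.bdd_unary.add hn.bdd_unary)).add hy.bdd) fun c i _ => ?_).left
  obtain ⟨hwit, hrest⟩ := length_round_iterate_le (gs c) (n0 c) (D c) (x c)
    (s := (true, ((y c).take (D c)).take (nw c), (y c).drop (D c))) (List.length_take_le _ _) i
  have hdrop : ((y c).drop (D c)).length ≤ (y c).length := List.length_drop ▸ Nat.sub_le _ _
  simp only [length_prodEnc, length_listEnc_encodeBool, length_encodeBool]
  dsimp only at hrest
  omega

end PolyTime

end Stoq

namespace Stoq

open Matrix

/-! ### Quadratic forms of powers of positive semidefinite matrices -/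

theorem pow_le_of_logConvex {m : ℕ → ℝ} (h0 : m 0 = 1) (hm : ∀ k, 0 ≤ m k)
    (hconv : ∀ k, m (k + 1) ^ 2 ≤ m k * m (k + 2)) (k : ℕ) : m 1 ^ k ≤ m k := by
  have ratio : ∀ k, m 1 * m k ≤ m (k + 1) := by
    intro k
    induction k with
    | zero => rw [h0, mul_one]
    | succ k ih =>
      rcases (hm k).eq_or_lt with hk | hk
      · have hsq : m (k + 1) ^ 2 ≤ 0 := by simpa [← hk] using hconv k
        rw [pow_eq_zero_iff two_ne_zero |>.1 (hsq.antisymm (sq_nonneg _)), mul_zero]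
        exact hm _
      · refine le_of_mul_le_mul_left ?_ hk
        calc m k * (m 1 * m (k + 1)) = m 1 * m k * m (k + 1) := by ring
          _ ≤ m (k + 1) * m (k + 1) := mul_le_mul_of_nonneg_right ih (hm _)
          _ = m (k + 1) ^ 2 := (sq _).symm
          _ ≤ m k * m (k + 2) := hconv k
  induction k with
  | zero => rw [pow_zero, h0]
  | succ k ih =>
    rw [pow_succ']
    exact (mul_le_mul_of_nonneg_left ih (hm 1)).trans (ratio k)

section Powers

variable {ι : Type*} {A : Matrix ι ι ℝ}

theorem isSymm_of_posSemidef (hA : A.PosSemidef) : A.IsSymm := by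
  rw [IsSymm, ← conjTranspose_eq_transpose_of_trivial]
  exact hA.isHermitian

variable [Fintype ι]

theorem dotProduct_mulVec_self_nonneg (hA : A.PosSemidef) (u : ι → ℝ) :
    0 ≤ u ⬝ᵥ A *ᵥ u := by
  simpa using hA.dotProduct_mulVec_nonneg u

theorem dotProduct_mulVec_comm {R : Type*} [CommSemiring R] {A : Matrix ι ι R} (hA : A.IsSymm)
    (u v : ι → R) : u ⬝ᵥ A *ᵥ v = (A *ᵥ u) ⬝ᵥ v := by
  rw [dotProduct_mulVec, ← mulVec_transpose, hA.eq]

theorem sq_dotProduct_mulVec_le (hA : A.PosSemidef) (u v : ι → ℝ) :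
    (u ⬝ᵥ A *ᵥ v) ^ 2 ≤ (u ⬝ᵥ A *ᵥ u) * (v ⬝ᵥ A *ᵥ v) := by
  classical
  simp only [← toBilin'_apply']
  refine LinearMap.BilinForm.apply_sq_le_of_symm _ (fun w => ?_) ⟨fun w z => ?_⟩ u v
  · rw [toBilin'_apply']
    exact dotProduct_mulVec_self_nonneg hA w
  · rw [toBilin'_apply', toBilin'_apply', RingHom.id_apply,
      dotProduct_mulVec_comm (isSymm_of_posSemidef hA), dotProduct_comm]

theorem dotProduct_mulVec_mono (hA : ∀ i j, 0 ≤ A i j) {u v : ι → ℝ} (hu : 0 ≤ u) (h : u ≤ v) :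
    u ⬝ᵥ A *ᵥ u ≤ v ⬝ᵥ A *ᵥ v := by
  refine Finset.sum_le_sum fun i _ => mul_le_mul (h i) ?_ ?_ ((hu i).trans (h i))
  · exact Finset.sum_le_sum fun j _ => mul_le_mul_of_nonneg_left (h j) (hA i j)
  · exact Finset.sum_nonneg fun j _ => mul_nonneg (hA i j) (hu j)

theorem le_one_of_dotProduct_self_eq_one {u : ι → ℝ} (hu : u ⬝ᵥ u = 1) : u ≤ 1 := fun i =>
  le_of_sq_le_sq (by
    rw [Pi.one_apply, one_pow, sq, ← hu]
    exact Finset.single_le_sum (f := fun i => u i * u i) (fun j _ => mul_self_nonneg _)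
      (Finset.mem_univ i)) zero_le_one

theorem dotProduct_mulVec_mulVec_le (hA : A.PosSemidef) {ε : ℝ} (hε : 0 ≤ ε)
    (h : ∀ u : ι → ℝ, u ⬝ᵥ A *ᵥ u ≤ ε * (u ⬝ᵥ u)) (u : ι → ℝ) :
    (A *ᵥ u) ⬝ᵥ (A *ᵥ u) ≤ ε ^ 2 * (u ⬝ᵥ u) := by
  have self_nonneg : ∀ u : ι → ℝ, 0 ≤ u ⬝ᵥ u := fun u =>
    Finset.sum_nonneg fun i _ => mul_self_nonneg _
  rcases (self_nonneg (A *ᵥ u)).eq_or_lt with h0 | h0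
  · rw [← h0]
    exact mul_nonneg (sq_nonneg _) (self_nonneg u)
  · refine le_of_mul_le_mul_right ?_ h0
    calc _ = (u ⬝ᵥ A *ᵥ (A *ᵥ u)) ^ 2 := by
          rw [sq, dotProduct_mulVec_comm (isSymm_of_posSemidef hA) u]
      _ ≤ (u ⬝ᵥ A *ᵥ u) * ((A *ᵥ u) ⬝ᵥ A *ᵥ (A *ᵥ u)) := sq_dotProduct_mulVec_le hA _ _
      _ ≤ (ε * (u ⬝ᵥ u)) * (ε * ((A *ᵥ u) ⬝ᵥ (A *ᵥ u))) :=
        mul_le_mul (h _) (h _) (dotProduct_mulVec_self_nonneg hA _)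
          (mul_nonneg hε (self_nonneg u))
      _ = _ := by ring

variable [DecidableEq ι]

theorem sq_dotProduct_pow_succ_mulVec_le (hA : A.PosSemidef) (u : ι → ℝ) (k : ℕ) :
    (u ⬝ᵥ (A ^ (k + 1)) *ᵥ u) ^ 2 ≤ (u ⬝ᵥ (A ^ k) *ᵥ u) * (u ⬝ᵥ (A ^ (k + 2)) *ᵥ u) := by
  have hright : (A ^ k) *ᵥ (A *ᵥ u) = (A ^ (k + 1)) *ᵥ u := by rw [mulVec_mulVec, pow_succ]
  have hboth : (A *ᵥ u) ⬝ᵥ (A ^ (k + 1)) *ᵥ u = u ⬝ᵥ (A ^ (k + 2)) *ᵥ u := by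
    rw [pow_succ' A (k + 1), ← mulVec_mulVec, dotProduct_mulVec_comm (isSymm_of_posSemidef hA)]
  simpa only [hright, hboth] using sq_dotProduct_mulVec_le (hA.pow k) u (A *ᵥ u)

theorem pow_dotProduct_mulVec_le (hA : A.PosSemidef) {u : ι → ℝ} (hu : u ⬝ᵥ u = 1)
    (k : ℕ) : (u ⬝ᵥ A *ᵥ u) ^ k ≤ u ⬝ᵥ (A ^ k) *ᵥ u := by
  have h := pow_le_of_logConvex (m := fun k => u ⬝ᵥ (A ^ k) *ᵥ u) (by simpa using hu)
    (fun k => dotProduct_mulVec_self_nonneg (hA.pow k) u) (sq_dotProduct_pow_succ_mulVec_le hA u) k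
  simpa only [pow_one] using h

theorem pow_le_sum_pow (hA : A.PosSemidef) (hA₀ : ∀ i j, 0 ≤ A i j) {u : ι → ℝ}
    (hu : 0 ≤ u) (hu₁ : u ⬝ᵥ u = 1) (k : ℕ) :
    (u ⬝ᵥ A *ᵥ u) ^ k ≤ (1 : ι → ℝ) ⬝ᵥ (A ^ k) *ᵥ 1 :=
  (pow_dotProduct_mulVec_le hA hu₁ k).trans
    (dotProduct_mulVec_mono (pow_apply_nonneg hA₀ k) hu (le_one_of_dotProduct_self_eq_one hu₁))

theorem dotProduct_pow_mulVec_le (hA : A.PosSemidef) {ε : ℝ} (hε : 0 ≤ ε)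
    (h : ∀ u : ι → ℝ, u ⬝ᵥ A *ᵥ u ≤ ε * (u ⬝ᵥ u)) (k : ℕ) (u : ι → ℝ) :
    u ⬝ᵥ (A ^ k) *ᵥ u ≤ ε ^ k * (u ⬝ᵥ u) := by
  induction k using Nat.twoStepInduction generalizing u with
  | zero => simp
  | one => simpa using h u
  | more k ih _ =>
    calc u ⬝ᵥ (A ^ (k + 2)) *ᵥ u = (A *ᵥ u) ⬝ᵥ (A ^ k) *ᵥ (A *ᵥ u) := by
          rw [← dotProduct_mulVec_comm (isSymm_of_posSemidef hA), mulVec_mulVec, mulVec_mulVec,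
            mul_assoc, ← pow_succ, ← pow_succ']
      _ ≤ ε ^ k * ((A *ᵥ u) ⬝ᵥ (A *ᵥ u)) := ih _
      _ ≤ ε ^ k * (ε ^ 2 * (u ⬝ᵥ u)) :=
        mul_le_mul_of_nonneg_left (dotProduct_mulVec_mulVec_le hA hε h u) (pow_nonneg hε k)
      _ = _ := by ring

end Powers

/-! ### Circuits as permutations of basis labels -/

section Circuits

variable {N : ℕ}

theorem Gate.apply_apply (g : Gate N) (b : Fin N → Bool) : g.apply (g.apply b) = b := by
  cases g with
  | X t => simp [Gate.apply]
  | CNOT c t h => simp [Gate.apply, Function.update_of_ne h]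
  | Toffoli c₁ c₂ t h h₁ h₂ =>
    simp [Gate.apply, Function.update_of_ne h₁, Function.update_of_ne h₂]

/-- The action of a circuit on basis labels. -/
def runLabels (gs : List (Gate N)) (b : Fin N → Bool) : Fin N → Bool :=
  gs.foldl (fun b g => g.apply b) b

theorem runLabels_cons (g : Gate N) (gs : List (Gate N)) (b : Fin N → Bool) :
    runLabels (g :: gs) b = runLabels gs (g.apply b) := rfl

theorem runLabels_append (gs gs' : List (Gate N)) (b : Fin N → Bool) :
    runLabels (gs ++ gs') b = runLabels gs' (runLabels gs b) := List.foldl_append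

theorem runLabels_reverse (gs : List (Gate N)) (b : Fin N → Bool) :
    runLabels gs.reverse (runLabels gs b) = b := by
  induction gs generalizing b with
  | nil => rfl
  | cons g gs ih =>
    rw [runLabels_cons, List.reverse_cons, runLabels_append, ih]
    exact g.apply_apply b

theorem eq_runLabels_iff {gs : List (Gate N)} {b b' : Fin N → Bool} :
    b' = runLabels gs b ↔ b = runLabels gs.reverse b' := by
  constructor
  · rintro rfl
    exact (runLabels_reverse gs b).symm
  · rintro rfl
    simpa only [List.reverse_reverse] using (runLabels_reverse gs.reverse b').symm

theorem circuitMatrix_apply (gs : List (Gate N)) (b' b : Fin N → Bool) :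
    circuitMatrix gs b' b = if b' = runLabels gs b then 1 else 0 := by
  induction gs generalizing b with
  | nil =>
    simp only [circuitMatrix, runLabels, one_apply, List.foldl_nil]
    congr
  | cons g gs ih =>
    rw [circuitMatrix, mul_apply]
    simp only [ih, Gate.matrix, runLabels_cons, of_apply, mul_ite, mul_one, mul_zero,
      Finset.sum_ite_eq', Finset.mem_univ, if_true]
    congr

theorem circuitMatrix_append (gs gs' : List (Gate N)) :
    circuitMatrix (gs ++ gs') = circuitMatrix gs' * circuitMatrix gs := by
  induction gs with
  | nil => simp [circuitMatrix]
  | cons g gs ih => rw [List.cons_append, circuitMatrix, ih, circuitMatrix, Matrix.mul_assoc]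

theorem circuitMatrix_conjTranspose (gs : List (Gate N)) :
    (circuitMatrix gs)ᴴ = circuitMatrix gs.reverse := by
  ext b' b
  rw [conjTranspose_apply, circuitMatrix_apply, circuitMatrix_apply]
  simp only [eq_runLabels_iff (b := b') (b' := b)]
  split <;> simp

theorem circuitMatrix_reverse_mul (gs : List (Gate N)) :
    circuitMatrix gs.reverse * circuitMatrix gs = 1 := by
  rw [← circuitMatrix_append]
  ext b' b
  rw [circuitMatrix_apply, runLabels_append, runLabels_reverse, one_apply]

theorem forall_ne_eq_iff_eq_or_eq_update {ι : Type*} [DecidableEq ι] (t : ι) (b b' : ι → Bool) :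
    (∀ i, i ≠ t → b' i = b i) ↔ b' = b ∨ b' = Function.update b t (!b t) := by
  have heq : b' = b ↔ b' t = b t ∧ ∀ i, i ≠ t → b' i = b i := by
    rw [← Function.eq_update_iff, Function.update_eq_self]
  rw [heq, Function.eq_update_iff, ← or_and_right]
  exact (and_iff_right (Bool.eq_or_eq_not _ _)).symm

end Circuits

/-! ### The acceptance probability as a quadratic form -/

namespace StoqVerifier

variable {n : ℕ} (V : StoqVerifier n)

/-- The circuit that applies the gates of the verifier, flips the first qubit, and undoes the gates.
Since `|+⟩⟨+| = (1 + X) / 2`, it carries all of the output measurement. -/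
def conjFlip : List (Gate V.qubits) :=
  V.gates ++ .X ⟨0, V.pos⟩ :: V.gates.reverse

theorem reverse_conjFlip : V.conjFlip.reverse = V.conjFlip := by
  simp [conjFlip]

theorem eq_runLabels_conjFlip_iff {b b' : Fin V.qubits → Bool} :
    b' = runLabels V.conjFlip b ↔ b = runLabels V.conjFlip b' := by
  rw [eq_runLabels_iff, reverse_conjFlip]

theorem outProjector_eq :
    V.outProjector = (1 / 2 : ℂ) • (1 + circuitMatrix [.X ⟨0, V.pos⟩]) := by
  ext b' b
  have flip : runLabels [.X ⟨0, V.pos⟩] b =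
    Function.update b ⟨0, V.pos⟩ (!b ⟨0, V.pos⟩) := rfl
  have flip_ne : b ≠ Function.update b ⟨0, V.pos⟩ (!b ⟨0, V.pos⟩) := fun h => by
    simpa using congrFun h ⟨0, V.pos⟩
  rw [Matrix.smul_apply, Matrix.add_apply, circuitMatrix_apply, one_apply, outProjector, of_apply,
    flip]
  simp only [forall_ne_eq_iff_eq_or_eq_update]
  by_cases hb : b' = b
  · subst hb
    simp [flip_ne]
  · simp [hb]

theorem conj_outProjector :
    (circuitMatrix V.gates)ᴴ * V.outProjector * circuitMatrix V.gates =
      (1 / 2 : ℂ) • (1 + circuitMatrix V.conjFlip) := by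
  rw [outProjector_eq, circuitMatrix_conjTranspose, conjFlip, circuitMatrix_append, circuitMatrix,
    Matrix.mul_smul, Matrix.smul_mul, Matrix.mul_add, Matrix.add_mul, Matrix.mul_one,
    circuitMatrix_reverse_mul]
  simp [circuitMatrix, Matrix.mul_assoc]

/-- A basis label carries the input `x`, the witness `w` and zeros; the qubits prepared in `|+⟩` are
not restricted. -/
def Loaded (x : Fin n → Bool) (w : Fin V.nw → Bool) (b : Fin V.qubits → Bool) : Prop :=
  V.inputPart b = x ∧ V.witnessPart b = w ∧ V.zeroPart b = fun _ => false

instance (x : Fin n → Bool) (w : Fin V.nw → Bool) : DecidablePred (V.Loaded x w) :=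
  fun _ => inferInstanceAs (Decidable (_ ∧ _ ∧ _))

/-- The isometry that prepares the initial state. -/
noncomputable def loadMatrix (x : Fin n → Bool) :
    Matrix (Fin V.qubits → Bool) (Fin V.nw → Bool) ℝ :=
  of fun b w => if V.Loaded x w b then (1 / √2) ^ V.np else 0

/-- The output projector conjugated by the circuit, a matrix with real entries. -/
noncomputable def realProjector : Matrix (Fin V.qubits → Bool) (Fin V.qubits → Bool) ℝ :=
  of fun b' b => ((if b' = b then 1 else 0) + if b = runLabels V.conjFlip b' then 1 else 0) / 2

/-- The matrix of the quadratic form that gives the acceptance probability. -/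
noncomputable def acceptMatrix (x : Fin n → Bool) : Matrix (Fin V.nw → Bool) (Fin V.nw → Bool) ℝ :=
  (V.loadMatrix x)ᵀ * V.realProjector * V.loadMatrix x

theorem realProjector_map_ofReal :
    V.realProjector.map Complex.ofReal = (1 / 2 : ℂ) • (1 + circuitMatrix V.conjFlip) := by
  ext b' b
  rw [Matrix.smul_apply, Matrix.add_apply, circuitMatrix_apply, one_apply, map_apply, realProjector,
    of_apply]
  simp only [eq_runLabels_conjFlip_iff (b' := b')]
  split_ifs <;> norm_num

theorem realProjector_mul_apply {κ : Type*} (M : Matrix (Fin V.qubits → Bool) κ ℝ)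
    (b : Fin V.qubits → Bool) (j : κ) :
    (V.realProjector * M) b j = (M b j + M (runLabels V.conjFlip b) j) / 2 := by
  rw [mul_apply]
  simp only [realProjector, of_apply, add_div, add_mul, Finset.sum_add_distrib, ite_div, zero_div,
    ite_mul, zero_mul, Finset.sum_ite_eq, Finset.sum_ite_eq', Finset.mem_univ, if_true]
  ring

theorem realProjector_transpose : V.realProjectorᵀ = V.realProjector := by
  ext b' b
  simp only [transpose_apply, realProjector, of_apply, eq_runLabels_conjFlip_iff (b' := b'),
    eq_comm (a := b) (b := b')]

theorem realProjector_mul_self : V.realProjector * V.realProjector = V.realProjector := by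
  ext b' b
  have involution : runLabels V.conjFlip (runLabels V.conjFlip b') = b' :=
    (V.eq_runLabels_conjFlip_iff.1 rfl).symm
  rw [realProjector_mul_apply]
  simp only [realProjector, of_apply, involution, eq_comm (a := runLabels V.conjFlip b') (b := b),
    eq_comm (a := b') (b := b)]
  ring

theorem posSemidef_acceptMatrix (x : Fin n → Bool) : (V.acceptMatrix x).PosSemidef := by
  have factorization : V.acceptMatrix x =
      (V.realProjector * V.loadMatrix x)ᴴ * (V.realProjector * V.loadMatrix x) := by
    rw [conjTranspose_eq_transpose_of_trivial, transpose_mul, realProjector_transpose,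
      Matrix.mul_assoc, ← Matrix.mul_assoc V.realProjector, realProjector_mul_self, acceptMatrix,
      Matrix.mul_assoc]
  rw [factorization]
  exact posSemidef_conjTranspose_mul_self _

theorem loadMatrix_nonneg (x : Fin n → Bool) (b : Fin V.qubits → Bool) (w : Fin V.nw → Bool) :
    0 ≤ V.loadMatrix x b w := by
  rw [loadMatrix, of_apply]
  split
  · positivity
  · rfl

theorem acceptMatrix_nonneg (x : Fin n → Bool) (w w' : Fin V.nw → Bool) :
    0 ≤ V.acceptMatrix x w w' := by
  rw [acceptMatrix, Matrix.mul_assoc, mul_apply]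
  refine Finset.sum_nonneg fun b _ => mul_nonneg (V.loadMatrix_nonneg x b w) ?_
  rw [realProjector_mul_apply]
  exact div_nonneg (add_nonneg (V.loadMatrix_nonneg x _ _) (V.loadMatrix_nonneg x _ _)) zero_le_two

theorem acceptMatrix_apply_mul_two_pow (x : Fin n → Bool) (w w' : Fin V.nw → Bool) :
    V.acceptMatrix x w w' * 2 ^ (V.np + 1) =
      (Finset.univ.filter fun b => V.Loaded x w b ∧ V.Loaded x w' b).card +
      (Finset.univ.filter fun b =>
        V.Loaded x w b ∧ V.Loaded x w' (runLabels V.conjFlip b)).card := by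
  have amplitude_sq : ((1 / √2) ^ V.np * (1 / √2) ^ V.np : ℝ) * 2 ^ V.np = 1 := by
    have half : (1 / √2 * (1 / √2) * 2 : ℝ) = 1 := by
      rw [div_mul_div_comm, Real.mul_self_sqrt zero_le_two]
      norm_num
    rw [← mul_pow, ← mul_pow, half, one_pow]
  rw [acceptMatrix, Matrix.mul_assoc, mul_apply, Finset.card_filter, Finset.card_filter]
  push_cast
  rw [← Finset.sum_add_distrib, Finset.sum_mul]
  refine Finset.sum_congr rfl fun b _ => ?_
  rw [realProjector_mul_apply]
  simp only [transpose_apply, loadMatrix, of_apply, pow_succ]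
  by_cases hw : V.Loaded x w b <;> by_cases hw' : V.Loaded x w' b <;>
    by_cases hflip : V.Loaded x w' (runLabels V.conjFlip b) <;>
    simp only [hw, hw', hflip, if_true, if_false, and_true, and_false, and_self] <;> linarith

theorem initialState_eq_mulVec (x : Fin n → Bool) (ψ : (Fin V.nw → Bool) → ℂ) :
    V.initialState x ψ = ((V.loadMatrix x).map Complex.ofReal) *ᵥ ψ := by
  funext b
  rw [initialState, mulVec, dotProduct, Finset.sum_eq_single (V.witnessPart b)]
  · rw [map_apply, loadMatrix, of_apply]
    by_cases hx : V.inputPart b = x <;> by_cases h0 : V.zeroPart b = fun _ => false <;>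
      simp [Loaded, hx, h0, mul_comm]
  · intro w _ hw
    simp [loadMatrix, Loaded, hw.symm]
  · simp

theorem acceptMatrix_map_ofReal (x : Fin n → Bool) :
    (V.acceptMatrix x).map Complex.ofReal = ((V.loadMatrix x).map Complex.ofReal)ᴴ *
      V.realProjector.map Complex.ofReal * (V.loadMatrix x).map Complex.ofReal := by
  have map_mul : ∀ {l m o : Type} [Fintype m] (M : Matrix l m ℝ) (M' : Matrix m o ℝ),
      (M * M').map Complex.ofReal = M.map Complex.ofReal * M'.map Complex.ofReal :=
    fun M M' => Matrix.map_mul (f := Complex.ofRealHom)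
  rw [acceptMatrix, map_mul, map_mul]
  congr 2
  ext
  simp

theorem acceptProb_eq (x : Fin n → Bool) (ψ : (Fin V.nw → Bool) → ℂ) :
    V.acceptProb x ψ = (star ψ ⬝ᵥ ((V.acceptMatrix x).map Complex.ofReal) *ᵥ ψ).re := by
  rw [acceptProb, conj_outProjector, ← realProjector_map_ofReal, initialState_eq_mulVec,
    acceptMatrix_map_ofReal, star_mulVec, ← dotProduct_mulVec, mulVec_mulVec, mulVec_mulVec,
    Matrix.mul_assoc]

theorem acceptProb_le (x : Fin n → Bool) (ψ : (Fin V.nw → Bool) → ℂ) :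
    V.acceptProb x ψ ≤ (fun w => ‖ψ w‖) ⬝ᵥ V.acceptMatrix x *ᵥ fun w => ‖ψ w‖ := by
  rw [acceptProb_eq]
  refine (Complex.re_le_norm _).trans ((norm_sum_le _ _).trans (Finset.sum_le_sum fun w _ => ?_))
  rw [norm_mul, Pi.star_apply, norm_star]
  refine mul_le_mul_of_nonneg_left ((norm_sum_le _ _).trans (Finset.sum_le_sum fun w' _ => ?_))
    (norm_nonneg _)
  rw [norm_mul]
  refine mul_le_mul_of_nonneg_right (le_of_eq ?_) (norm_nonneg _)
  simp only [map_apply]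
  rw [Complex.norm_real, Real.norm_of_nonneg (V.acceptMatrix_nonneg x w w')]

theorem acceptProb_ofReal (x : Fin n → Bool) (u : (Fin V.nw → Bool) → ℝ) :
    V.acceptProb x (fun w => (u w : ℂ)) = u ⬝ᵥ V.acceptMatrix x *ᵥ u := by
  rw [acceptProb_eq]
  simp [dotProduct, mulVec]

theorem dotProduct_acceptMatrix_mulVec_le {x : Fin n → Bool} {ε : ℝ}
    (h : ∀ ψ, IsState ψ → V.acceptProb x ψ ≤ ε) (u : (Fin V.nw → Bool) → ℝ) :
    u ⬝ᵥ V.acceptMatrix x *ᵥ u ≤ ε * (u ⬝ᵥ u) := by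
  have hnonneg : 0 ≤ u ⬝ᵥ u := Finset.sum_nonneg fun i _ => mul_self_nonneg _
  rcases hnonneg.eq_or_lt with h0 | hpos
  · rw [dotProduct_self_eq_zero.1 h0.symm]
    simp
  · have isState : IsState fun w => (((√(u ⬝ᵥ u))⁻¹ • u) w : ℂ) := by
      have hsum : ∑ i, u i ^ 2 = u ⬝ᵥ u := by simp [dotProduct, sq]
      simp only [IsState, Complex.norm_real, Real.norm_eq_abs, sq_abs, Pi.smul_apply, smul_eq_mul,
        mul_pow, inv_pow, Real.sq_sqrt hnonneg]
      rw [← Finset.mul_sum, hsum, inv_mul_cancel₀ hpos.ne']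
    have hle := h _ isState
    rw [acceptProb_ofReal, mulVec_smul, smul_dotProduct, dotProduct_smul, smul_smul, smul_eq_mul,
      ← mul_inv, Real.mul_self_sqrt hnonneg, inv_mul_le_iff₀ hpos] at hle
    rwa [mul_comm]

end StoqVerifier

end Stoq

namespace Stoq

/-! ### The string simulation and the action on labels -/

section Simulation

variable {N : ℕ}

/-- The indices of the qubits of a gate in the form that `applyCtl` reads: the target followed by
the controls. -/
def Gate.indices : Gate N → List ℕ
  | .X t => [t]
  | .CNOT c t _ => [t, c]
  | .Toffoli c₁ c₂ t _ _ _ => [t, c₂, c₁]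

theorem Gate.foldl_parseStep_code (g : Gate N) (a : ℕ × List ℕ × List (List ℕ)) (ha : a.1 = 0) :
    g.code.foldl parseStep a = (0, g.indices, g.indices :: a.2.2) := by
  cases g <;> simp [Gate.code, Gate.indices, parseStep, ha]

theorem foldl_parseStep_flatMap_code (gates : List (Gate N)) (a : ℕ × List ℕ × List (List ℕ))
    (ha : a.1 = 0) : ((gates.flatMap Gate.code).foldl parseStep a).2.2 =
      (gates.map Gate.indices).reverse ++ a.2.2 := by
  induction gates generalizing a with
  | nil => rfl
  | cons g gates ih =>
    rw [List.flatMap_cons, List.foldl_append, g.foldl_parseStep_code a ha, ih _ rfl, List.map_cons,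
      List.reverse_cons, List.append_assoc, List.singleton_append]

theorem parse_flatMap_code (gates : List (Gate N)) :
    parse (gates.flatMap Gate.code) = (gates.map Gate.indices).reverse := by
  rw [parse, foldl_parseStep_flatMap_code gates _ rfl, List.append_nil]

theorem getD_ofFn_append {α : Type*} (b : Fin N → α) (t : List α) (i : Fin N) (d : α) :
    (List.ofFn b ++ t).getD i d = b i := by
  rw [List.getD_append _ _ _ _ (by simp), List.getD_eq_getElem _ _ (by simp), List.getElem_ofFn]

theorem set_ofFn_append {α : Type*} (b : Fin N → α) (t : List α) (i : Fin N) (y : α) :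
    (List.ofFn b ++ t).set i y = List.ofFn (Function.update b i y) ++ t := by
  rw [List.set_append_left _ _ (by simp)]
  congr 1
  refine List.ext_getElem (by simp) fun j _ _ => ?_
  rw [List.getElem_set, List.getElem_ofFn, List.getElem_ofFn, Function.update_apply]
  simp only [Fin.ext_iff, eq_comm]

theorem applyCtl_ofFn_append (g : Gate N) (b : Fin N → Bool) (t : List Bool) :
    applyCtl (List.ofFn b ++ t) g.indices = List.ofFn (g.apply b) ++ t := by
  cases g <;>
    simp only [applyCtl, Gate.indices, Gate.apply, getD_ofFn_append, set_ofFn_append,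
      List.headD_cons, List.tail_cons, List.foldl_cons, List.foldl_nil, Bool.true_and,
      Bool.xor_true, Bool.and_comm]

theorem runGates_ofFn_append (gs : List (Gate N)) (b : Fin N → Bool) (t : List Bool) :
    runGates (gs.map Gate.indices) (List.ofFn b ++ t) = List.ofFn (runLabels gs b) ++ t := by
  induction gs generalizing b with
  | nil => rfl
  | cons g gs ih =>
    rw [runLabels_cons, ← ih, ← applyCtl_ofFn_append]
    rfl

end Simulation

namespace StoqVerifier

variable {n : ℕ} (V : StoqVerifier n)

/-- The gates of a verifier as lists of indices, the last gate first. -/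
def revIndices : List (List ℕ) := (V.gates.map Gate.indices).reverse

/-- The basis label with given input, witness and random bits, and with zeros in the ancillas
`|0⟩`. -/
def label (x : Fin n → Bool) (w : Fin V.nw → Bool) (s : Fin V.np → Bool) : Fin V.qubits → Bool :=
  Fin.append (Fin.append (Fin.append x w) fun _ => false) s

/-- The part of a basis label that belongs to the ancillas `|+⟩`. -/
def plusPart (b : Fin V.qubits → Bool) : Fin V.np → Bool := fun i => b (Fin.natAdd _ i)

theorem append_parts (b : Fin V.qubits → Bool) :
    Fin.append (Fin.append (Fin.append (V.inputPart b) (V.witnessPart b)) (V.zeroPart b))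
      (V.plusPart b) = b := by
  have input : Fin.append (V.inputPart b) (V.witnessPart b) =
      fun i => b (Fin.castAdd V.np (Fin.castAdd V.n0 i)) :=
    Fin.append_castAdd_natAdd (f := fun i => b (Fin.castAdd V.np (Fin.castAdd V.n0 i)))
  have ancilla : Fin.append (fun i => b (Fin.castAdd V.np (Fin.castAdd V.n0 i))) (V.zeroPart b) =
      fun i => b (Fin.castAdd V.np i) :=
    Fin.append_castAdd_natAdd (f := fun i => b (Fin.castAdd V.np i))
  rw [input, ancilla]
  exact Fin.append_castAdd_natAdd

theorem ofFn_eq_append_parts (b : Fin V.qubits → Bool) :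
    List.ofFn b = List.ofFn (V.inputPart b) ++ (List.ofFn (V.witnessPart b) ++
      (List.ofFn (V.zeroPart b) ++ List.ofFn (V.plusPart b))) := by
  conv_lhs => rw [← V.append_parts b]
  simp only [List.ofFn_fin_append, List.append_assoc]

theorem ofFn_label (x : Fin n → Bool) (w : Fin V.nw → Bool) (s : Fin V.np → Bool) :
    List.ofFn (V.label x w s) =
      List.ofFn x ++ (List.ofFn w ++ (List.replicate V.n0 false ++ List.ofFn s)) := by
  simp only [label, List.ofFn_fin_append, List.ofFn_const, List.append_assoc]

theorem loaded_label (x : Fin n → Bool) (w : Fin V.nw → Bool) (s : Fin V.np → Bool) :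
    V.Loaded x w (V.label x w s) := by
  refine ⟨funext fun i => ?_, funext fun i => ?_, funext fun i => ?_⟩
  · simp [inputPart, label]
  · simp [witnessPart, label]
  · simp [zeroPart, label]

theorem plusPart_label (x : Fin n → Bool) (w : Fin V.nw → Bool) (s : Fin V.np → Bool) :
    V.plusPart (V.label x w s) = s := by
  funext i
  simp [plusPart, label]

theorem label_plusPart {x : Fin n → Bool} {w : Fin V.nw → Bool} {b : Fin V.qubits → Bool}
    (h : V.Loaded x w b) : V.label x w (V.plusPart b) = b := by
  obtain ⟨rfl, rfl, h⟩ := h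
  rw [label, ← h, append_parts]

theorem card_filter_loaded_and (x : Fin n → Bool) (w : Fin V.nw → Bool)
    (Q : (Fin V.qubits → Bool) → Prop) [DecidablePred Q] :
    (Finset.univ.filter fun b => V.Loaded x w b ∧ Q b).card =
      (Finset.univ.filter fun s => Q (V.label x w s)).card := by
  refine Finset.card_nbij' V.plusPart (V.label x w) (fun b hb => ?_) (fun s hs => ?_)
    (fun b hb => V.label_plusPart (Finset.mem_filter.1 hb).2.1) fun s _ => V.plusPart_label x w s
  · obtain ⟨hloaded, hQ⟩ := (Finset.mem_filter.1 hb).2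
    exact Finset.mem_filter.2 ⟨Finset.mem_univ _, (V.label_plusPart hloaded).symm ▸ hQ⟩
  · exact Finset.mem_filter.2
      ⟨Finset.mem_univ _, V.loaded_label x w s, (Finset.mem_filter.1 hs).2⟩

/-- The label after one round on the label `b`, where the bit `c` tells whether the first qubit is
flipped. -/
def roundLabel (c : Bool) (b : Fin V.qubits → Bool) : Fin V.qubits → Bool :=
  bif c then runLabels V.conjFlip b else b

theorem runLabels_reverse_update (c : Bool) (b : Fin V.qubits → Bool) :
    runLabels V.gates.reverse (Function.update (runLabels V.gates b) ⟨0, V.pos⟩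
      (xor (runLabels V.gates b ⟨0, V.pos⟩) c)) = V.roundLabel c b := by
  cases c with
  | false =>
    rw [Bool.xor_false, Function.update_eq_self, runLabels_reverse]
    rfl
  | true =>
    rw [Bool.xor_true, roundLabel, cond_true, conjFlip, runLabels_append, runLabels_cons]
    rfl

theorem roundReg_eq (x : Fin n → Bool) (w : Fin V.nw → Bool) (c : Bool) (s : Fin V.np → Bool)
    (t : List Bool) :
    roundReg V.revIndices V.n0 (List.ofFn x) (List.ofFn w) (c :: (List.ofFn s ++ t)) =
      List.ofFn (V.roundLabel c (V.label x w s)) ++ t := by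
  have loaded : List.ofFn x ++ (List.ofFn w ++ (List.replicate V.n0 false ++ (List.ofFn s ++ t))) =
      List.ofFn (V.label x w s) ++ t := by
    simp only [ofFn_label, List.append_assoc]
  have compute : ∀ b : Fin V.qubits → Bool, runGates V.revIndices.reverse (List.ofFn b ++ t) =
      List.ofFn (runLabels V.gates b) ++ t := fun b => by
    rw [revIndices, List.reverse_reverse, runGates_ofFn_append]
  have uncompute : ∀ b : Fin V.qubits → Bool, runGates V.revIndices (List.ofFn b ++ t) =
      List.ofFn (runLabels V.gates.reverse b) ++ t := fun b => by
    rw [revIndices, ← List.map_reverse, runGates_ofFn_append]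
  have getD_zero : ∀ b : Fin V.qubits → Bool, (List.ofFn b ++ t).getD 0 false = b ⟨0, V.pos⟩ :=
    fun b => getD_ofFn_append b t ⟨0, V.pos⟩ false
  have set_zero : ∀ (b : Fin V.qubits → Bool) (y : Bool), (List.ofFn b ++ t).set 0 y =
      List.ofFn (Function.update b ⟨0, V.pos⟩ y) ++ t :=
    fun b => set_ofFn_append b t ⟨0, V.pos⟩
  rw [roundReg, List.tail_cons, List.headD_cons, loaded, compute, getD_zero, set_zero, uncompute,
    runLabels_reverse_update]

theorem length_roundWit (x : Fin n → Bool) (w : Fin V.nw → Bool) (v : List Bool) :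
    (roundWit V.revIndices V.nw V.n0 (List.ofFn x) (List.ofFn w) v).length = V.nw := by
  rw [roundWit, List.length_take, List.length_drop, roundReg, length_runGates, List.length_set,
    length_runGates]
  simp

theorem roundWit_eq (x : Fin n → Bool) (w : Fin V.nw → Bool) (c : Bool) (s : Fin V.np → Bool)
    (t : List Bool) :
    roundWit V.revIndices V.nw V.n0 (List.ofFn x) (List.ofFn w) (c :: (List.ofFn s ++ t)) =
      List.ofFn (V.witnessPart (V.roundLabel c (V.label x w s))) := by
  rw [roundWit, roundReg_eq, ofFn_eq_append_parts]
  simp only [List.append_assoc]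
  rw [List.drop_left' (by simp), List.take_left' (by simp)]

theorem roundOk_iff (x : Fin n → Bool) (w : Fin V.nw → Bool) (c : Bool) (s : Fin V.np → Bool)
    (t : List Bool) :
    roundOk V.revIndices V.nw V.n0 (List.ofFn x) (List.ofFn w) (c :: (List.ofFn s ++ t)) = true ↔
      V.inputPart (V.roundLabel c (V.label x w s)) = x ∧
        V.zeroPart (V.roundLabel c (V.label x w s)) = fun _ => false := by
  rw [roundOk, roundWit_eq, roundReg_eq, beq_iff_eq]
  generalize V.roundLabel c (V.label x w s) = b
  have take_eq : (List.ofFn b ++ t).take ((List.ofFn x).length + (V.nw + V.n0)) =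
      List.ofFn (V.inputPart b) ++ (List.ofFn (V.witnessPart b) ++ List.ofFn (V.zeroPart b)) := by
    have split : List.ofFn b ++ t = (List.ofFn (V.inputPart b) ++ (List.ofFn (V.witnessPart b) ++
        List.ofFn (V.zeroPart b))) ++ (List.ofFn (V.plusPart b) ++ t) := by
      simp only [V.ofFn_eq_append_parts b, List.append_assoc]
    rw [split, List.take_left' (by simp)]
  rw [take_eq, ← List.ofFn_const]
  refine ⟨fun h => ?_, fun ⟨hx, h0⟩ => by rw [hx, h0]⟩
  obtain ⟨hx, hrest⟩ := List.append_inj h (by simp)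
  exact ⟨List.ofFn_inj.1 hx, List.ofFn_inj.1 (List.append_cancel_left hrest)⟩

/-- The block `v` leads from the witness bits `w` to `w'` in one successful round. -/
def leadsTo (x : Fin n → Bool) (w w' : Fin V.nw → Bool) (v : List Bool) : Bool :=
  roundOk V.revIndices V.nw V.n0 (List.ofFn x) (List.ofFn w) v &&
    roundWit V.revIndices V.nw V.n0 (List.ofFn x) (List.ofFn w) v == List.ofFn w'

theorem leadsTo_iff (x : Fin n → Bool) (w w' : Fin V.nw → Bool) (c : Bool) (s : Fin V.np → Bool)
    (t : List Bool) :
    V.leadsTo x w w' (c :: (List.ofFn s ++ t)) = true ↔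
      V.Loaded x w' (V.roundLabel c (V.label x w s)) := by
  rw [leadsTo, Bool.and_eq_true, beq_iff_eq, roundOk_iff, roundWit_eq, List.ofFn_inj, Loaded]
  tauto

end StoqVerifier

end Stoq

namespace Stoq

open Matrix

/-! ### Counting accepted strings -/

/-- The number of strings of length `m` with the property `P`, in the form in which `SharpP` counts
witnesses. -/
def countBits (m : ℕ) (P : List Bool → Bool) : ℕ :=
  (Finset.univ.filter fun v : Fin m → Bool => P (List.ofFn v) = true).card

theorem countBits_eq_sum (m : ℕ) (P : List Bool → Bool) :
    countBits m P = ∑ v : Fin m → Bool, if P (List.ofFn v) = true then 1 else 0 :=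
  Finset.card_filter _ _

theorem countBits_add (a b : ℕ) (P : List Bool → Bool) :
    countBits (a + b) P = ∑ u : Fin a → Bool, countBits b fun l => P (List.ofFn u ++ l) := by
  simp only [countBits_eq_sum]
  rw [← Fintype.sum_prod_type', ← Fintype.sum_equiv (Fin.appendEquiv a b)]
  intro u
  simp only [Fin.appendEquiv, Equiv.coe_fn_mk, List.ofFn_fin_append]

theorem countBits_one_add (m : ℕ) (P : List Bool → Bool) :
    countBits (1 + m) P =
      (countBits m fun l => P (false :: l)) + countBits m fun l => P (true :: l) := by
  rw [countBits_add, Fintype.sum_equiv (Equiv.funUnique (Fin 1) Bool) _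
    (fun c => countBits m fun l => P (c :: l)), Fintype.sum_bool, add_comm]
  exact fun _ => rfl

theorem countBits_const (m : ℕ) (c : Bool) :
    (countBits m fun _ => c) = if c = true then 2 ^ m else 0 := by
  cases c <;> simp [countBits]

theorem exists_eq_ofFn {α : Type*} {l : List α} {m : ℕ} (h : l.length = m) :
    ∃ u : Fin m → α, l = List.ofFn u := by
  subst h
  exact ⟨l.get, (List.ofFn_get l).symm⟩

theorem sum_take_ofFn {α M : Type*} [Fintype α] [AddCommMonoid M] (m e : ℕ) (G : List α → M) :
    ∑ u : Fin (m + e) → α, G ((List.ofFn u).take m) =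
      Fintype.card α ^ e • ∑ w : Fin m → α, G (List.ofFn w) := by
  have append : ∀ p : (Fin m → α) × (Fin e → α),
      G (List.ofFn p.1) = G ((List.ofFn (Fin.appendEquiv m e p)).take m) := fun p => by
    simp only [Fin.appendEquiv, Equiv.coe_fn_mk, List.ofFn_fin_append]
    rw [List.take_left' (by simp)]
  rw [← Fintype.sum_equiv (Fin.appendEquiv m e) _ _ append, Fintype.sum_prod_type, Finset.smul_sum]
  simp

theorem iterate_round_fst_of_false (gs : List (List ℕ)) (nw n0 D k : ℕ) (x w y : List Bool) :
    ((round gs nw n0 D x)^[k] (false, w, y)).1 = false := by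
  induction k generalizing w y with
  | zero => rfl
  | succ _ ih => exact ih _ _

namespace StoqVerifier

variable {n : ℕ} (V : StoqVerifier n)

theorem countBits_leadsTo_cons (x : Fin n → Bool) (w w' : Fin V.nw → Bool) (c : Bool) (e : ℕ) :
    (countBits (V.np + e) fun l => V.leadsTo x w w' (c :: l)) =
      (Finset.univ.filter fun b =>
        V.Loaded x w b ∧ V.Loaded x w' (V.roundLabel c b)).card * 2 ^ e := by
  rw [countBits_add, V.card_filter_loaded_and x w fun b => V.Loaded x w' (V.roundLabel c b),
    Finset.card_filter, Finset.sum_mul]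
  refine Finset.sum_congr rfl fun s _ => ?_
  have decide_eq : ∀ l, V.leadsTo x w w' (c :: (List.ofFn s ++ l)) =
      decide (V.Loaded x w' (V.roundLabel c (V.label x w s))) := fun l => by
    rw [Bool.eq_iff_iff, leadsTo_iff, decide_eq_true_iff]
  simp only [decide_eq, countBits_const, decide_eq_true_iff, ite_mul, one_mul, zero_mul]

/-- The number of blocks of `D` bits that lead from the witness bits `w` to `w'`. -/
def roundMatrix (D : ℕ) (x : Fin n → Bool) : Matrix (Fin V.nw → Bool) (Fin V.nw → Bool) ℕ :=
  of fun w w' => countBits D (V.leadsTo x w w')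

theorem roundMatrix_apply {D : ℕ} (hD : V.np + 1 ≤ D) (x : Fin n → Bool)
    (w w' : Fin V.nw → Bool) :
    (V.roundMatrix D x w w' : ℝ) = V.acceptMatrix x w w' * 2 ^ D := by
  obtain ⟨e, rfl⟩ := Nat.exists_eq_add_of_le hD
  rw [pow_add, ← mul_assoc, acceptMatrix_apply_mul_two_pow, roundMatrix, of_apply,
    show V.np + 1 + e = 1 + (V.np + e) by ring, countBits_one_add, countBits_leadsTo_cons,
    countBits_leadsTo_cons]
  push_cast
  rw [add_mul]
  rfl

theorem countBits_iterate_round_append {D : ℕ} (m k : ℕ) (x : Fin n → Bool)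
    (w : Fin V.nw → Bool) (v : Fin D → Bool) :
    (countBits m fun l => ((round V.revIndices V.nw V.n0 D (List.ofFn x))^[k + 1]
        (true, List.ofFn w, List.ofFn v ++ l)).1) =
      ∑ w' : Fin V.nw → Bool, if V.leadsTo x w w' (List.ofFn v) = true then
        countBits m fun l =>
          ((round V.revIndices V.nw V.n0 D (List.ofFn x))^[k] (true, List.ofFn w', l)).1
      else 0 := by
  obtain ⟨u, hu⟩ := exists_eq_ofFn (V.length_roundWit x w (List.ofFn v))
  have round_append : ∀ l,
      round V.revIndices V.nw V.n0 D (List.ofFn x) (true, List.ofFn w, List.ofFn v ++ l) =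
        (roundOk V.revIndices V.nw V.n0 (List.ofFn x) (List.ofFn w) (List.ofFn v),
          List.ofFn u, l) := fun l => by
    simp only [round, Bool.true_and]
    rw [List.take_left' (by simp), List.drop_left' (by simp), hu]
  simp only [Function.iterate_succ_apply, round_append, leadsTo, hu]
  cases roundOk V.revIndices V.nw V.n0 (List.ofFn x) (List.ofFn w) (List.ofFn v) with
  | false => simp [iterate_round_fst_of_false, countBits_const]
  | true => simp [List.ofFn_inj]

theorem countBits_iterate_round (D k : ℕ) (x : Fin n → Bool) (w : Fin V.nw → Bool) :
    (countBits (k * D) fun y =>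
      ((round V.revIndices V.nw V.n0 D (List.ofFn x))^[k] (true, List.ofFn w, y)).1) =
      ((V.roundMatrix D x) ^ k *ᵥ 1) w := by
  induction k generalizing w with
  | zero => simp [countBits]
  | succ k ih =>
    rw [Nat.succ_mul, add_comm, countBits_add, pow_succ', ← mulVec_mulVec, mulVec, dotProduct]
    simp only [countBits_iterate_round_append, ih]
    rw [Finset.sum_comm]
    refine Finset.sum_congr rfl fun w' _ => ?_
    rw [roundMatrix, of_apply, countBits_eq_sum, Finset.sum_mul]
    simp only [ite_mul, one_mul, zero_mul]

/-- The number of strings of `k + 1` blocks of `D` bits, the first of which holds the witness bits,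
for which `k` rounds on the input `x` succeed. -/
def acceptCount (D k : ℕ) (x : Fin n → Bool) : ℕ :=
  countBits (D + k * D) fun y => accepts V.revIndices V.nw V.n0 D k (List.ofFn x) y

theorem acceptCount_eq_roundMatrix {D : ℕ} (hD : V.nw ≤ D) (k : ℕ) (x : Fin n → Bool) :
    V.acceptCount D k x =
      2 ^ (D - V.nw) * ((1 : (Fin V.nw → Bool) → ℕ) ⬝ᵥ (V.roundMatrix D x) ^ k *ᵥ 1) := by
  obtain ⟨e, he⟩ := Nat.exists_eq_add_of_le hD
  have accepts_append : ∀ (u : Fin D → Bool) (l : List Bool),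
      accepts V.revIndices V.nw V.n0 D k (List.ofFn x) (List.ofFn u ++ l) =
        ((round V.revIndices V.nw V.n0 D (List.ofFn x))^[k]
          (true, (List.ofFn u).take V.nw, l)).1 := fun u l => by
    rw [accepts, List.take_left' (by simp), List.drop_left' (by simp)]
  have sum_take := sum_take_ofFn (α := Bool) V.nw e fun w => countBits (k * D) fun l =>
    ((round V.revIndices V.nw V.n0 D (List.ofFn x))^[k] (true, w, l)).1
  rw [← he, Fintype.card_bool, smul_eq_mul] at sum_take
  simp only [acceptCount, countBits_add D, accepts_append, sum_take, countBits_iterate_round,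
    dotProduct, Pi.one_apply, one_mul]
  rw [he, Nat.add_sub_cancel_left]

theorem acceptCount_eq_acceptMatrix {D : ℕ} (hD : V.qubits + 1 ≤ D) (k : ℕ)
    (x : Fin n → Bool) :
    (V.acceptCount D k x : ℝ) =
      2 ^ (D - V.nw) * (2 ^ D) ^ k *
        ((1 : (Fin V.nw → Bool) → ℝ) ⬝ᵥ (V.acceptMatrix x) ^ k *ᵥ 1) := by
  have hnp : V.np + 1 ≤ D := by dsimp only [qubits] at hD; omega
  have hnw : V.nw ≤ D := by dsimp only [qubits] at hD; omega
  have map_round : (V.roundMatrix D x).map (Nat.castRingHom ℝ) =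
      (2 ^ D : ℝ) • V.acceptMatrix x := by
    ext w w'
    rw [map_apply, Matrix.smul_apply, smul_eq_mul, mul_comm]
    exact V.roundMatrix_apply hnp x w w'
  have map_round_pow : ((V.roundMatrix D x) ^ k).map (Nat.castRingHom ℝ) =
      ((2 ^ D : ℝ) ^ k) • (V.acceptMatrix x) ^ k := by
    rw [← smul_pow, ← map_round]
    exact map_pow (Nat.castRingHom ℝ).mapMatrix _ _
  rw [V.acceptCount_eq_roundMatrix hnw, mul_assoc, ← smul_eq_mul (a := ((2 : ℝ) ^ D) ^ k),
    ← dotProduct_smul, ← smul_mulVec, ← map_round_pow]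
  simp [dotProduct, mulVec]

end StoqVerifier

end Stoq

namespace Stoq

open Computability Matrix

/-! ### Uniformity -/

theorem encodeStrings_eq_prodEnc :
    encodeStrings = prodEnc (fun l : List Bool => l) fun l => l := rfl

theorem encodeNats_eq_prodEnc : encodeNats = prodEnc encodeNat encodeNat := rfl

theorem indexEnc_eq_flatMap (l : List ℕ) :
    indexEnc l = (encodeTallies l).flatMap fun b => [if b then some true else none] := by
  induction l with
  | nil => rfl
  | cons k l ih =>
    have encodeTallies_cons :
        encodeTallies (k :: l) = List.replicate k true ++ false :: encodeTallies l := by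
      simp [encodeTallies]
    rw [encodeTallies_cons, indexEnc, listEnc_cons, unaryEncodeNat_eq_replicate,
      List.flatMap_append, List.flatMap_cons, ← ih]
    simp [List.flatMap_replicate, List.map_replicate]

section Context

variable {γ C : Type} [Finite C] {ec : γ → List C} {V : ∀ n, StoqVerifier n} {m : γ → ℕ}

section Uniform

variable (hV : Uniform V) (hm : PolyTime ec unaryEncodeNat m)
include hV hm

theorem Uniform.polyTime_description : PolyTime ec indexEnc fun c =>
    [(V (m c)).nw, (V (m c)).n0, (V (m c)).np] ++ (V (m c)).gates.flatMap Gate.code := by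
  have tallies : PolyTime unaryEncodeNat encodeTallies fun n =>
      [(V n).nw, (V n).n0, (V n).np] ++ (V n).gates.flatMap Gate.code :=
    PolyTime.recode hV fun _ => rfl
  have recode : PolyTime encodeTallies indexEnc fun l => l := PolyTime.flatMap _ indexEnc_eq_flatMap
  exact recode.comp (tallies.comp hm)

theorem Uniform.polyTime_nw : PolyTime ec unaryEncodeNat fun c => (V (m c)).nw :=
  (PolyTime.getD 0 (PolyTime.const 0) (hV.polyTime_description hm)).recode fun _ => rfl

theorem Uniform.polyTime_n0 : PolyTime ec unaryEncodeNat fun c => (V (m c)).n0 :=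
  (PolyTime.getD 0 (PolyTime.const 1) (hV.polyTime_description hm)).recode fun _ => rfl

theorem Uniform.polyTime_revIndices :
    PolyTime ec (listEnc indexEnc) fun c => (V (m c)).revIndices :=
  (PolyTime.drop (PolyTime.const 3) (hV.polyTime_description hm)).parse.recode fun c =>
    congrArg _ (parse_flatMap_code (V (m c)).gates)

end Uniform

theorem PolyTimeFraction.comp {α Γ : Type} [Finite Γ] {ea : α → List Γ} {f : α → ℝ}
    (hf : PolyTimeFraction ea f) {a : γ → α} (ha : PolyTime ec ea a) :
    PolyTimeFraction ec fun c => f (a c) := by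
  obtain ⟨g, hg, hgf⟩ := hf
  exact ⟨fun c => g (a c), hg.comp ha, fun c => hgf (a c)⟩

theorem PolyTimeFraction.mul_two_pow_pow {f : γ → ℝ} (hf : PolyTimeFraction ec f) {D k : γ → ℕ}
    (hD : PolyTime ec unaryEncodeNat D) (hk : PolyTime ec unaryEncodeNat k) :
    PolyTimeFraction ec fun c => (f c * 2 ^ D c) ^ k c := by
  obtain ⟨g, hg, hgf⟩ := hf
  rw [encodeNats_eq_prodEnc] at hg
  refine ⟨fun c => (((g c).1 * 2 ^ D c) ^ k c, (g c).2 ^ k c), ?_,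
    fun c => ⟨pow_pos (hgf c).1 _, ?_⟩⟩
  · rw [encodeNats_eq_prodEnc]
    exact ((hg.left.mul ((PolyTime.const 2).pow hD)).pow hk).pair (hg.right.pow hk)
  · push_cast
    rw [(hgf c).2, ← div_pow, div_mul_eq_mul_div]

end Context

theorem polyTime_length : PolyTime (id : List Bool → List Bool) unaryEncodeNat List.length :=
  PolyTime.code_length (ec := fun l : List Bool => l)

theorem Uniform.polyTime_accepts {V : ∀ n, StoqVerifier n} (hV : Uniform V) (D k : Polynomial ℕ) :
    PolyTime encodeStrings encodeBool fun p : List Bool × List Bool =>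
      accepts (V p.1.length).revIndices (V p.1.length).nw (V p.1.length).n0 (D.eval p.1.length)
        (k.eval p.1.length) p.1 p.2 := by
  rw [encodeStrings_eq_prodEnc]
  have input := PolyTime.fst (ea := fun l : List Bool => l) (eb := fun l : List Bool => l)
  have witness := PolyTime.snd (ea := fun l : List Bool => l) (eb := fun l : List Bool => l)
  have length := polyTime_length.comp input
  exact PolyTime.accepts (hV.polyTime_revIndices length) (hV.polyTime_nw length)
    (hV.polyTime_n0 length) input.toList (PolyTime.unary_eval D length)
    (PolyTime.unary_eval k length) witness.toList

theorem Uniform.acceptCount_mem_sharpP {V : ∀ n, StoqVerifier n} (hV : Uniform V)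
    (D k : Polynomial ℕ) :
    (fun x => (V x.length).acceptCount (D.eval x.length) (k.eval x.length) x.get) ∈ SharpP := by
  refine ⟨D + k * D, _, hV.polyTime_accepts D k, fun x => ?_⟩
  dsimp only [StoqVerifier.acceptCount]
  rw [List.ofFn_get, Polynomial.eval_add, Polynomial.eval_mul]
  rfl

/-! ### The gap -/

theorem one_sub_inv_pow_le {q : ℕ} (hq : 0 < q) (m : ℕ) :
    (1 - 1 / (q : ℝ)) ^ (q * m) ≤ (1 / 2) ^ m := by
  have hq₁ : (1 : ℝ) ≤ q := by exact_mod_cast hq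
  have base_nonneg : 0 ≤ 1 - 1 / (q : ℝ) := by
    rw [sub_nonneg, div_le_one (by linarith)]
    exact hq₁
  rw [pow_mul]
  exact pow_le_pow_left₀ (pow_nonneg base_nonneg _)
    ((Real.one_sub_div_pow_le_exp_neg hq₁).trans Real.exp_neg_one_lt_half.le) _

theorem pow_le_of_gap {a b : ℝ} {q : ℕ} (ha : 0 ≤ a) (hb : b ≤ 1) (hq : 0 < q)
    (h : 1 / (q : ℝ) ≤ b - a) (m : ℕ) : a ^ (q * m) ≤ (1 / 2) ^ m * b ^ (q * m) := by
  have inv_pos : (0 : ℝ) < 1 / q := by positivity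
  have b_nonneg : 0 ≤ b := by linarith
  have le_mul : a ≤ (1 - 1 / (q : ℝ)) * b := by nlinarith
  calc a ^ (q * m) ≤ ((1 - 1 / (q : ℝ)) * b) ^ (q * m) := pow_le_pow_left₀ ha le_mul _
    _ = (1 - 1 / (q : ℝ)) ^ (q * m) * b ^ (q * m) := mul_pow _ _ _
    _ ≤ _ := mul_le_mul_of_nonneg_right (one_sub_inv_pow_le hq m) (pow_nonneg b_nonneg _)

namespace StoqVerifier

variable {n : ℕ} (V : StoqVerifier n)

theorem le_acceptCount {D : ℕ} (hD : V.qubits + 1 ≤ D) (k : ℕ) {x : Fin n → Bool}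
    {ψ : (Fin V.nw → Bool) → ℂ} (hψ : IsState ψ) {ε : ℝ} (hε : 0 ≤ ε)
    (h : ε ≤ V.acceptProb x ψ) : (ε * 2 ^ D) ^ k ≤ V.acceptCount D k x := by
  have norm_dotProduct_norm : (fun w => ‖ψ w‖) ⬝ᵥ (fun w => ‖ψ w‖) = 1 := by
    rw [← hψ]
    simp only [dotProduct, sq]
  have pow_le : ε ^ k ≤ (1 : (Fin V.nw → Bool) → ℝ) ⬝ᵥ (V.acceptMatrix x) ^ k *ᵥ 1 :=
    (pow_le_pow_left₀ hε (h.trans (V.acceptProb_le x ψ)) k).trans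
      (pow_le_sum_pow (V.posSemidef_acceptMatrix x) (V.acceptMatrix_nonneg x)
        (fun w => norm_nonneg (ψ w)) norm_dotProduct_norm k)
  rw [V.acceptCount_eq_acceptMatrix hD, mul_pow, mul_comm]
  gcongr
  exact le_mul_of_one_le_left (by positivity) (one_le_pow₀ one_le_two)

theorem acceptCount_le {D : ℕ} (hD : V.qubits + 1 ≤ D) (k : ℕ) {x : Fin n → Bool}
    {ε : ℝ} (hε : 0 ≤ ε) (h : ∀ ψ, IsState ψ → V.acceptProb x ψ ≤ ε) :
    (V.acceptCount D k x : ℝ) ≤ 2 ^ D * (ε * 2 ^ D) ^ k := by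
  have hnw : V.nw ≤ D := by dsimp only [qubits] at hD; omega
  have one_dotProduct_one :
      (1 : (Fin V.nw → Bool) → ℝ) ⬝ᵥ 1 = 2 ^ V.nw := by simp [dotProduct]
  calc (V.acceptCount D k x : ℝ)
      = 2 ^ (D - V.nw) * (2 ^ D) ^ k *
          ((1 : (Fin V.nw → Bool) → ℝ) ⬝ᵥ (V.acceptMatrix x) ^ k *ᵥ 1) :=
        V.acceptCount_eq_acceptMatrix hD k x
    _ ≤ 2 ^ (D - V.nw) * (2 ^ D) ^ k * (ε ^ k * 2 ^ V.nw) := by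
        rw [← one_dotProduct_one]
        gcongr
        exact dotProduct_pow_mulVec_le (V.posSemidef_acceptMatrix x) hε
          (V.dotProduct_acceptMatrix_mulVec_le h) k 1
    _ = 2 ^ (D - V.nw + V.nw) * (ε * 2 ^ D) ^ k := by ring
    _ = 2 ^ D * (ε * 2 ^ D) ^ k := by rw [Nat.sub_add_cancel hnw]

theorem acceptCount_le_half {D : ℕ} (hD : V.qubits + 1 ≤ D) {x : Fin n → Bool} {q : ℕ}
    (hq : 0 < q) {ε ε' : ℝ} (hε : 0 ≤ ε) (hε' : ε' ≤ 1) (hgap : 1 / (q : ℝ) ≤ ε' - ε)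
    (h : ∀ ψ, IsState ψ → V.acceptProb x ψ ≤ ε) :
    (V.acceptCount D (q * (D + 1)) x : ℝ) ≤ 1 / 2 * (ε' * 2 ^ D) ^ (q * (D + 1)) := by
  have two_pow_mul_half : (2 : ℝ) ^ D * (1 / 2) ^ (D + 1) = 1 / 2 := by
    rw [pow_succ, ← mul_assoc, ← mul_pow]
    norm_num
  calc (V.acceptCount D (q * (D + 1)) x : ℝ)
      ≤ 2 ^ D * (ε * 2 ^ D) ^ (q * (D + 1)) := V.acceptCount_le hD _ hε h
    _ = 2 ^ D * (ε ^ (q * (D + 1)) * (2 ^ D) ^ (q * (D + 1))) := by rw [mul_pow]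
    _ ≤ 2 ^ D * ((1 / 2) ^ (D + 1) * ε' ^ (q * (D + 1)) * (2 ^ D) ^ (q * (D + 1))) := by
        gcongr
        exact pow_le_of_gap hε hε' hq hgap _
    _ = 2 ^ D * (1 / 2) ^ (D + 1) * (ε' * 2 ^ D) ^ (q * (D + 1)) := by rw [mul_pow]; ring
    _ = 1 / 2 * (ε' * 2 ^ D) ^ (q * (D + 1)) := by rw [two_pow_mul_half]

end StoqVerifier

end Stoq

theorem theorem4 : Stoq.StoqMA ⊆ Stoq.SBP := by
  rintro L ⟨V, εyes, εno, hV, ⟨q, hq⟩, hyes, -, hε, ⟨r, hr⟩, hLyes, hLno⟩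
  let D : Polynomial ℕ := q + 1
  let k : Polynomial ℕ := r * (D + 1)
  have hD (m : ℕ) : (V m).qubits + 1 ≤ D.eval m := by simpa [D] using (hq m).1
  have hk (m : ℕ) : k.eval m = r.eval m * (D.eval m + 1) := by simp [k]
  have hpos (m : ℕ) : 0 < εyes m := (hε m).1.trans_lt (hε m).2.1
  refine ⟨_, hV.acceptCount_mem_sharpP D k,
    fun x => (εyes x.length * 2 ^ D.eval x.length) ^ k.eval x.length,
    fun x => pow_pos (mul_pos (hpos _) (by positivity)) _,
    (hyes.comp Stoq.polyTime_length).mul_two_pow_pow (.unary_eval D Stoq.polyTime_length)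
      (.unary_eval k Stoq.polyTime_length), fun x hx => ?_, fun x hx => ?_⟩
  · obtain ⟨ψ, hψ, h⟩ := hLyes x hx
    exact (V x.length).le_acceptCount (hD _) _ hψ (hpos _).le h
  · simp only [hk]
    exact (V x.length).acceptCount_le_half (hD _) (hr _).1 (hε _).1 (hε _).2.2 (hr _).2
      (hLno x hx)
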